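/- **Model.** Let $N$ be a number of locations; a link is an ordered pair $(i,j)$, $i\ne j$. Given are travel times $\xi_{ij}>0$, a supply cost $c$ and a price cap $p_{\max}$ with $0<c<p_{\max}$, bounds $0<\alpha_{\min}\le\alpha_{\max}$, $0<\beta_{\min}\le\beta_{\max}$, and shock bounds $\underline\epsilon\le\overline\epsilon$ with $\alpha_{\min}-\beta_{\max}p_{\max}+\underline\epsilon\ge 0$. The true parameters $\theta_{ij}=(\alpha_{ij},\beta_{ij})$ lie in $B=[\alpha_{\min},\alpha_{\max}]\times[\beta_{\min},\beta_{\max}]$. On day $d$, at price $p_{ij}^d$, the demand on a link is $\Psi_{ij}^d=\alpha_{ij}-\beta_{ij}p_{ij}^d+\epsilon_{ij}^d$. For each link the shocks $\epsilon_{ij}^d\in[\underline\epsilon,\overline\epsilon]$ have mean $0$ and the same law $F_{ij}$ on all days, and the vectors $\epsilon^1,\epsilon^2,\dots$ are independent over days. With supplies $w_{ij}^d$ the payoff is $$\Pi(p^d,w^d,\epsilon^d)=\sum_{i\ne j}\xi_{ij}\min\{\Psi_{ij}^d,w_{ij}^d\}\,p_{ij}^d-\sum_{i\ne j}\xi_{ij}w_{ij}^d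 c .$$ For a parameter vector $\theta'=(\alpha',\beta')\in\prod_{i\neq j} B$ let $(p^*(\theta'),w^*(\theta'))$ maximize the expected payoff computed with demand parameters $\theta'$, subject to $p_{ij}\le p_{\max}$, $w_{ij}\ge0$, flow balance $\sum_{j\ne i}w_{ij}=\sum_{j\ne i}w_{ji}$ for all $i$, and $w_{ij}=\alpha'_{ij}-\beta'_{ij}p_{ij}$. The clairvoyant decision is $(p^*(\theta),w^*(\theta))$. **NRPS policy** with parameters $\rho\in(0,\infty)$, $\eta\in(0,\tfrac12)$. The initial guess $\hat\theta^0$ is random with values in $\prod_{i\neq j} B$, of arbitrary law, independent of the shocks. For $n\ge1$, $\hat\theta_{ij}^n$ is the least squares fit of $\Psi_{ij}^\tau\approx\bar\alpha-\bar\beta p_{ij}^\tau$ over the days $\tau=1,\dots,n$, projected onto $B$. On an odd day $d$ the provider uses $(p^*(\hat\theta^{d-1}),w^*(\hat\theta^{d-1}))$. On an even day $d$ it uses the prices $p_{ij}^*(\hat\theta^{d-2})-\frac{\rho}{\hat\beta_{ij}^{d-2}}d^{-\eta}$ and the supplies $w_{ij}^*(\hat\theta^{d-2})+\rho d^{-\eta}$.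 The time-average regret is $$\Delta_D=\mathbb E\Big[\frac1D\sum_{d=1}^D\big(\Pi(p^*(\theta),w^*(\theta),\epsilon^d)-\Pi(p^d,w^d,\epsilon^d)\big)\Big].$$ **Theorem.** There are finite positive functions $\Phi_2,\Phi_3,\Phi_4$ of $(\rho,\eta)\in(0,\infty)\times(0,\frac12)$, depending otherwise only on $N$, $\xi$, $c$, $p_{\max}$, $\alpha_{\min},\alpha_{\max},\beta_{\min},\beta_{\max},\underline\epsilon,\overline\epsilon$ (and not on $D$, on $\theta$, on the laws of the shocks or on the law of $\hat\theta^0$), such that the following holds for all integers $D>4+e^{1/(1-2\eta)}$. Assume that the price caps $p_{ij}\le p_{\max}$ have zero dual variables in the clairvoyant problem and, almost surely, in the problems solved by the policy on the odd days $d\le D$ (that is, with the supply eliminated, the optimal prices satisfy the KKT conditions with all multipliers of the price caps equal to $0$). Then the average in the definition of $\Delta_D$ is integrable and $$\Delta_D<\Phi_2(\rho,\eta)\,D^{-1}+\Phi_3(\rho,\eta)\,(\ln D)^{1/2}D^{\eta-1/2}+\Phi_4(\rho,\eta)\,D^{-\eta}.$$ In particular, for $\eta=\frac14$ there is $K(\rho)$,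 with the same dependence, such that $\Delta_D\le K(\rho)\,(\ln D)^{1/2}D^{-1/4}$ under the same conditions. -/

import Mathlib

open MeasureTheory ProbabilityTheory

noncomputable section

namespace NRPS

/-- A link is an ordered pair `(i, j)` of different locations. -/
abbrev Link (N : ℕ) := {l : Fin N × Fin N // l.1 ≠ l.2}

/-- The primitives of the model that the provider knows: travel times, supply cost, price cap,
the bounds on the demand parameters, and the bounds on the demand shocks. -/
structure Market (N : ℕ) where
  ξ : Link N → ℝ
  c : ℝ
  pmax : ℝ
  αmin : ℝ
  αmax : ℝ
  βmin : ℝ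
  βmax : ℝ
  εlo : ℝ
  εhi : ℝ
  ξ_pos : ∀ l, 0 < ξ l
  c_pos : 0 < c
  c_lt_pmax : c < pmax
  αmin_pos : 0 < αmin
  βmin_pos : 0 < βmin
  demand_nonneg : 0 ≤ αmin - βmax * pmax + εlo

/-- Demand parameters: `θ l = (α l, β l)` for each link `l`. -/
abbrev Params (N : ℕ) := Link N → ℝ × ℝ

/-- The prices and the supplies (vehicle departure rates) chosen for one day. -/
structure Decision (N : ℕ) where
  price : Link N → ℝ
  supply : Link N → ℝ

/-- What the provider knows about a past day: its decision and the realized demand. -/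
structure Record (N : ℕ) where
  demand : Link N → ℝ
  decision : Decision N

/-- A policy: `π d` maps the history of the first `d` days to the decision for day `d + 1`. -/
abbrev Policy (N : ℕ) := (d : ℕ) → (Fin d → Record N) → Decision N

variable {N : ℕ}

/-- The parameters of every link lie in `[αmin, αmax] × [βmin, βmax]`. -/
def Market.InBox (M : Market N) (θ : Params N) : Prop :=
  ∀ l, (θ l).1 ∈ Set.Icc M.αmin M.αmax ∧ (θ l).2 ∈ Set.Icc M.βmin M.βmax

/-- The demand `α - β p + ε` on each link. -/
def demand (θ : Params N) (p ε : Link N → ℝ) (l : Link N) : ℝ :=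
  (θ l).1 - (θ l).2 * p l + ε l

/-- At every location the departure rate equals the arrival rate. -/
def FlowBalance (w : Link N → ℝ) : Prop :=
  ∀ i : Fin N, ∑ l ∈ Finset.univ.filter (fun l : Link N => l.1.1 = i), w l =
    ∑ l ∈ Finset.univ.filter (fun l : Link N => l.1.2 = i), w l

/-- The payoff per time slot on a day with decision `x` and shocks `ε`. -/
def Market.payoff (M : Market N) (θ : Params N) (x : Decision N) (ε : Link N → ℝ) : ℝ :=
  ∑ l, M.ξ l * min (demand θ x.price ε l) (x.supply l) * x.price l
    - ∑ l, M.ξ l * x.supply l * M.c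

/-- The expectation of `payoff` when the shock on link `l` has law `F l`. -/
def Market.expectedPayoff (M : Market N) (F : Link N → Measure ℝ) (θ : Params N)
    (x : Decision N) : ℝ :=
  ∑ l, M.ξ l * (∫ s, min ((θ l).1 - (θ l).2 * x.price l + s) (x.supply l) ∂(F l)) * x.price l
    - ∑ l, M.ξ l * x.supply l * M.c

/-- The constraints of the provider's daily problem: the price cap, nonnegative supply, vehicle
flow balance, and supply equal to expected demand (the shocks have mean zero). -/
structure Market.Feasible (M : Market N) (θ : Params N) (x : Decision N) : Prop where
  cap : ∀ l, x.price l ≤ M.pmax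
  supply_nonneg : ∀ l, 0 ≤ x.supply l
  balance : FlowBalance x.supply
  local_balance : ∀ l, x.supply l = (θ l).1 - (θ l).2 * x.price l

/-- `x` maximizes the expected payoff over the feasible decisions, under parameters `θ`. -/
def Market.IsOptimal (M : Market N) (F : Link N → Measure ℝ) (θ : Params N)
    (x : Decision N) : Prop :=
  M.Feasible θ x ∧ ∀ y, M.Feasible θ y → M.expectedPayoff F θ y ≤ M.expectedPayoff F θ x

instance : Nonempty (Decision N) := ⟨⟨0, 0⟩⟩

/-- The optimal solution `(p*(θ), w*(θ))` of the daily problem under parameters `θ`. -/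
def Market.optimal (M : Market N) (F : Link N → Measure ℝ) (θ : Params N) : Decision N :=
  Classical.epsilon (M.IsOptimal F θ)

/-- `ε⁻`, the integral of the shock over its nonpositive values. -/
def negPart (F : Measure ℝ) : ℝ := ∫ s in Set.Iic 0, s ∂F

/-- KKT conditions of the daily problem after the supply has been eliminated:
maximize `∑ ξ (α - β p + ε⁻) p - ∑ ξ (α - β p) c` subject to flow balance of `α - β p`
(multipliers `σ`) and to the price caps `p ≤ pmax` (multipliers `μ`). -/
structure Market.IsKKT (M : Market N) (F : Link N → Measure ℝ) (θ : Params N)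
    (p : Link N → ℝ) (σ : Fin N → ℝ) (μ : Link N → ℝ) : Prop where
  cap : ∀ l, p l ≤ M.pmax
  balance : FlowBalance (fun l => (θ l).1 - (θ l).2 * p l)
  dual_nonneg : ∀ l, 0 ≤ μ l
  slackness : ∀ l, μ l * (p l - M.pmax) = 0
  stationary : ∀ l, -M.ξ l * ((θ l).1 - (θ l).2 * p l + negPart (F l))
    + M.ξ l * (θ l).2 * p l - M.ξ l * (θ l).2 * M.c
    - σ l.1.1 * (θ l).2 + σ l.1.2 * (θ l).2 + μ l = 0

/-- The dual variables of all price caps vanish at the optimum under parameters `θ`. -/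
def Market.CapsInactive (M : Market N) (F : Link N → Measure ℝ) (θ : Params N) : Prop :=
  ∃ σ : Fin N → ℝ, M.IsKKT F θ (M.optimal F θ).price σ 0

/-- `ab = (a, b)` minimizes the sum of squared residuals on link `l`. -/
def IsLeastSquares {n : ℕ} (h : Fin n → Record N) (l : Link N) (ab : ℝ × ℝ) : Prop :=
  ∀ ab' : ℝ × ℝ,
    ∑ τ, ((h τ).demand l - (ab.1 - ab.2 * (h τ).decision.price l)) ^ 2 ≤
      ∑ τ, ((h τ).demand l - (ab'.1 - ab'.2 * (h τ).decision.price l)) ^ 2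

/-- The least squares estimate on link `l` from the history `h`. -/
def leastSquares {n : ℕ} (h : Fin n → Record N) (l : Link N) : ℝ × ℝ :=
  Classical.epsilon (IsLeastSquares h l)

/-- The estimate of the parameters after `n` days: the initial guess `θ₀` if `n = 0`, and
otherwise the least squares estimate truncated to the box of admissible parameters. -/
def Market.estimate (M : Market N) (θ₀ : Params N) {n : ℕ} (h : Fin n → Record N) : Params N :=
  fun l =>
    if n = 0 then θ₀ l
    else (max (min (leastSquares h l).1 M.αmax) M.αmin,
          max (min (leastSquares h l).2 M.βmax) M.βmin)

/-- The no-regret pricing and supply policy with control parameters `ρ`, `η` and initial guess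
`θ₀`. If `d` is even then day `d + 1` is odd, and the policy optimizes under the current estimate.
If `d` is odd then day `d + 1` is even, and the policy offsets the optimal decision under the
estimate from the first `d - 1` days. -/
def Market.policy (M : Market N) (F : Link N → Measure ℝ) (ρ η : ℝ) (θ₀ : Params N) :
    Policy N := fun d h =>
  if Even d then M.optimal F (M.estimate θ₀ h)
  else
    let θ' := M.estimate θ₀ (fun τ : Fin (d - 1) => h (Fin.castLE (Nat.sub_le d 1) τ))
    { price := fun l =>
        (M.optimal F θ').price l - ρ / (θ' l).2 * ((d + 1 : ℕ) : ℝ) ^ (-η)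
      supply := fun l => (M.optimal F θ').supply l + ρ * ((d + 1 : ℕ) : ℝ) ^ (-η) }

/-- The history of the first `d` days under policy `π`, when the true parameters are `θ` and
`e d` is the vector of shocks on day `d + 1`. -/
def history (θ : Params N) (π : Policy N) (e : ℕ → Link N → ℝ) : (d : ℕ) → Fin d → Record N
  | 0 => Fin.elim0
  | d + 1 => Fin.snoc (α := fun _ => Record N) (history θ π e d)
      { demand := demand θ (π d (history θ π e d)).price (e d)
        decision := π d (history θ π e d) }

/-- The average, over the first `D` days, of the payoff of the clairvoyant decision minus the
payoff of policy `π`, along one realization `e` of the shocks. -/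
def Market.averageGap (M : Market N) (F : Link N → Measure ℝ) (θ : Params N) (π : Policy N)
    (e : ℕ → Link N → ℝ) (D : ℕ) : ℝ :=
  (1 / (D : ℝ)) * ∑ d ∈ Finset.range D,
    (M.payoff θ (M.optimal F θ) (e d) - M.payoff θ (π d (history θ π e d)) (e d))

/-- The time-average regret of the (possibly random) policy `π` during the first `D` days. -/
def Market.regret (M : Market N) {Ω : Type*} [MeasurableSpace Ω] (P : Measure Ω)
    (F : Link N → Measure ℝ) (θ : Params N) (π : Ω → Policy N) (ε : ℕ → Ω → Link N → ℝ)
    (D : ℕ) : ℝ :=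
  ∫ ω, M.averageGap F θ (π ω) (fun d => ε d ω) D ∂P

/-- The assumptions on the true parameters `θ`, the laws `F` of the shocks, the shocks `ε`
(`ε d` is the vector of shocks on day `d + 1`), and the random initial guess `θ₀`. Shocks are
independent over days; nothing is assumed on the dependence between links within a day. -/
structure Market.IsEnvironment (M : Market N) {Ω : Type*} [MeasurableSpace Ω] (P : Measure Ω)
    (θ : Params N) (F : Link N → Measure ℝ) (ε : ℕ → Ω → Link N → ℝ) (θ₀ : Ω → Params N) :
    Prop where
  params_mem : M.InBox θ
  shock_measurable : ∀ d, Measurable (ε d)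
  shock_law : ∀ d l, P.map (fun ω => ε d ω l) = F l
  shock_bounded : ∀ l, ∀ᵐ s ∂(F l), s ∈ Set.Icc M.εlo M.εhi
  shock_mean : ∀ l, ∫ s, s ∂(F l) = 0
  shock_indep : iIndepFun ε P
  guess_measurable : Measurable θ₀
  guess_mem : ∀ᵐ ω ∂P, M.InBox (θ₀ ω)
  guess_indep : IndepFun θ₀ (fun ω d => ε d ω) P

end NRPS

end

/-! The loss of a day is controlled pathwise. The payoff is Lipschitz in the decision because `min`
is, so the loss is at most a constant times the distance between the policy's decision and the
clairvoyant one. That distance is at most a constant times the estimation error plus the deliberate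
offset `d ^ (-η)` (`abs_gap_le`).

Optimal decisions are Lipschitz in the parameters. When the cap multipliers vanish, the KKT
conditions are linear: prices are affine in the potential differences `σ i - σ j`, and flow balance
is a weighted Laplace equation for `σ` with weights `β / (2 ξ)`, bounded below. Testing this
equation with `σ`, or with the difference of two solutions, gives bounds and Lipschitz constants
(`abs_dual_le`, `abs_dual_sub_le`).

The estimation error is controlled through the self-normalized sum `S^T G⁻¹ S`, where `G` is the
Gram matrix of the regressors `(1, p k)` and `S` the noise vector. Under a rank one update it grows
by at most `2 e c + e² (log det G' - log det G)`, where `c` depends on the past and the current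
price only (`selfNorm_update`). The logarithms telescope to `O(log n)` and the terms `e c` have mean
zero, so the expectation is `O(log n)`. The two prices of each pair of days differ by at least a
multiple of `n ^ (-η)`, which forces `det G ≥ const * n ^ (2 - 2 η)` (`gramDet_ge`). Together these
give a mean error of order `√(log D) * n ^ (η - 1 / 2)`. No concentration inequality is needed.

Summation over the days gives the rates `D ^ (η - 1 / 2)`, with the factor `√(log D)`, and `D ^
(-η)`. The first two days, which rely on the initial guess, are bounded by the diameter of the
parameter box and give the term `1 / D`. -/

noncomputable section

/-! ### Least squares with regressors `(1, p)`: Gram determinants and self-normalized sums. -/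

namespace NRPS

/-- The determinant of the Gram matrix of the regressors `(1, p k)`, `k < n`. -/
def gramDet (p : ℕ → ℝ) (n : ℕ) : ℝ :=
  n * ∑ k ∈ Finset.range n, p k ^ 2 - (∑ k ∈ Finset.range n, p k) ^ 2

/-- The squared norm of the vector `∑ k < n, e k • (1, p k)` with respect to the inverse of the
Gram matrix of the regressors `(1, p k)`. -/
def selfNorm (p e : ℕ → ℝ) (n : ℕ) : ℝ :=
  ((∑ k ∈ Finset.range n, p k ^ 2) * (∑ k ∈ Finset.range n, e k) ^ 2
    - 2 * (∑ k ∈ Finset.range n, p k) * (∑ k ∈ Finset.range n, e k)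
      * (∑ k ∈ Finset.range n, e k * p k)
    + n * (∑ k ∈ Finset.range n, e k * p k) ^ 2) / gramDet p n

/-- The coefficient of `2 * e n` in the increment of `selfNorm`; it does not depend on `e n`. -/
def crossTerm (p e : ℕ → ℝ) (n : ℕ) : ℝ :=
  ((∑ k ∈ Finset.range n, p k ^ 2) * (∑ k ∈ Finset.range n, e k)
    - (∑ k ∈ Finset.range n, p k) * (∑ k ∈ Finset.range n, e k * p k)
    - (∑ k ∈ Finset.range n, p k) * p n * (∑ k ∈ Finset.range n, e k)
    + n * p n * (∑ k ∈ Finset.range n, e k * p k)) / gramDet p (n + 1)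

/-- The increment appears as a sum of squares, which makes monotonicity evident. -/
lemma gramDet_succ (p : ℕ → ℝ) (n : ℕ) :
    gramDet p (n + 1) = gramDet p n + ∑ k ∈ Finset.range n, (p k - p n) ^ 2 := by
  have h : ∑ k ∈ Finset.range n, (p k - p n) ^ 2 = ∑ k ∈ Finset.range n, p k ^ 2
      - 2 * p n * ∑ k ∈ Finset.range n, p k + n * p n ^ 2 := by
    simp only [sub_sq, Finset.sum_add_distrib, Finset.sum_sub_distrib, Finset.sum_const,
      Finset.card_range, nsmul_eq_mul, Finset.mul_sum]
    congr 2
    exact Finset.sum_congr rfl fun k _ => by ring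
  rw [h]
  simp only [gramDet, Finset.sum_range_succ]
  push_cast
  ring

lemma gramDet_mono (p : ℕ → ℝ) : Monotone (gramDet p) :=
  monotone_nat_of_le_succ fun n => by
    rw [gramDet_succ]
    exact le_add_of_nonneg_right (Finset.sum_nonneg fun _ _ => sq_nonneg _)

lemma gramDet_two (p : ℕ → ℝ) : gramDet p 2 = (p 0 - p 1) ^ 2 := by
  simp [gramDet, Finset.sum_range_succ]
  ring

/-- Two different prices make the matrix of regressors square and invertible, so normalizing by the
Gram matrix leaves the Euclidean norm of the errors. This starts the recursion. -/
lemma selfNorm_two {p : ℕ → ℝ} (e : ℕ → ℝ) (h : 0 < gramDet p 2) :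
    selfNorm p e 2 = e 0 ^ 2 + e 1 ^ 2 := by
  rw [selfNorm, div_eq_iff h.ne', gramDet_two]
  simp [Finset.sum_range_succ]
  ring

lemma gramDet_le {p : ℕ → ℝ} {b : ℝ} {n : ℕ} (hp : ∀ k < n, |p k| ≤ b) :
    gramDet p n ≤ n ^ 2 * b ^ 2 := by
  have h : ∑ k ∈ Finset.range n, p k ^ 2 ≤ n * b ^ 2 := by
    calc _ ≤ ∑ k ∈ Finset.range n, b ^ 2 :=
          Finset.sum_le_sum fun k hk =>
            sq_le_sq.2 ((hp k (Finset.mem_range.1 hk)).trans (le_abs_self b))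
      _ = _ := by simp
  have h' := mul_le_mul_of_nonneg_left h (Nat.cast_nonneg (α := ℝ) n)
  unfold gramDet
  nlinarith [sq_nonneg (∑ k ∈ Finset.range n, p k)]

/-- The algebraic form of the self-normalized recursion: a rank one update of the Gram matrix
`!![a, b; b, g]` by `(1, p)`, and of the vector `(x, y)` by `e • (1, p)`. -/
lemma selfNorm_update {a b g x y p e d d' : ℝ} (hd : d = a * g - b ^ 2)
    (hd' : d' = d + (g - 2 * b * p + a * p ^ 2)) (hpos : 0 < d)
    (hs : 0 ≤ g - 2 * b * p + a * p ^ 2) :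
    ((g + p ^ 2) * (x + e) ^ 2 - 2 * (b + p) * (x + e) * (y + e * p)
      + (a + 1) * (y + e * p) ^ 2) / d' ≤
      (g * x ^ 2 - 2 * b * x * y + a * y ^ 2) / d
        + 2 * e * ((g * x - b * y - b * p * x + a * p * y) / d')
        + e ^ 2 * (Real.log d' - Real.log d) := by
  have hpos' : 0 < d' := by linarith
  -- This is `log x ≤ x - 1` at `x = d / d'`.
  have hlog : (g - 2 * b * p + a * p ^ 2) / d' ≤ Real.log d' - Real.log d := by
    have h := Real.log_le_sub_one_of_pos (div_pos hpos hpos')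
    rw [Real.log_div hpos.ne' hpos'.ne'] at h
    have : (g - 2 * b * p + a * p ^ 2) / d' = 1 - d / d' := by
      field_simp
      linarith
    linarith
  -- The part free of `e` does not increase when the Gram matrix grows. After clearing denominators
  -- this is Cauchy–Schwarz, and its defect is the square of the numerator of the cross term.
  have hcs : (g * x ^ 2 - 2 * b * x * y + a * y ^ 2 + (p * x - y) ^ 2) / d' ≤
      (g * x ^ 2 - 2 * b * x * y + a * y ^ 2) / d := by
    rw [div_le_div_iff₀ hpos' hpos, hd']
    have : (g * x ^ 2 - 2 * b * x * y + a * y ^ 2) * (g - 2 * b * p + a * p ^ 2)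
        - (p * x - y) ^ 2 * d = (g * x - b * y - b * p * x + a * p * y) ^ 2 := by
      rw [hd]; ring
    nlinarith [sq_nonneg (g * x - b * y - b * p * x + a * p * y)]
  -- Expansion in powers of `e`.
  have hexp : ((g + p ^ 2) * (x + e) ^ 2 - 2 * (b + p) * (x + e) * (y + e * p)
      + (a + 1) * (y + e * p) ^ 2) / d' =
      (g * x ^ 2 - 2 * b * x * y + a * y ^ 2 + (p * x - y) ^ 2) / d'
        + 2 * e * ((g * x - b * y - b * p * x + a * p * y) / d')
        + e ^ 2 * ((g - 2 * b * p + a * p ^ 2) / d') := by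
    field_simp
    ring
  rw [hexp]
  have := mul_le_mul_of_nonneg_left hlog (sq_nonneg e)
  linarith

lemma selfNorm_succ_le {p : ℕ → ℝ} (e : ℕ → ℝ) {n : ℕ} (h : 0 < gramDet p n) :
    selfNorm p e (n + 1) ≤ selfNorm p e n + 2 * (e n * crossTerm p e n)
      + e n ^ 2 * (Real.log (gramDet p (n + 1)) - Real.log (gramDet p n)) := by
  have hs : gramDet p (n + 1) = gramDet p n + (∑ k ∈ Finset.range n, p k ^ 2
      - 2 * (∑ k ∈ Finset.range n, p k) * p n + n * p n ^ 2) := by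
    simp only [gramDet, Finset.sum_range_succ]
    push_cast
    ring
  have := selfNorm_update (x := ∑ k ∈ Finset.range n, e k)
    (y := ∑ k ∈ Finset.range n, e k * p k) (e := e n) (d := gramDet p n) rfl hs h
    (by linarith [gramDet_mono p n.le_succ])
  simp only [selfNorm, crossTerm, Finset.sum_range_succ, Nat.cast_succ] at this ⊢
  linarith

/-- The self-normalized sum grows at most logarithmically, up to a sum of cross terms. -/
lemma selfNorm_le {p e : ℕ → ℝ} {E : ℝ} (hdet : 0 < gramDet p 2) {n : ℕ} (hn : 2 ≤ n)
    (he : ∀ k, |e k| ≤ E) :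
    selfNorm p e n ≤ 2 * E ^ 2 + 2 * ∑ k ∈ Finset.Ico 2 n, e k * crossTerm p e k
      + E ^ 2 * (Real.log (gramDet p n) - Real.log (gramDet p 2)) := by
  have hsq : ∀ k, e k ^ 2 ≤ E ^ 2 := fun k => sq_le_sq.2 ((he k).trans (le_abs_self E))
  induction n, hn using Nat.le_induction with
  | base =>
    rw [selfNorm_two e hdet]
    simp
    linarith [hsq 0, hsq 1]
  | succ n hn ih =>
    have hpos : 0 < gramDet p n := hdet.trans_le (gramDet_mono p hn)
    have hlog : 0 ≤ Real.log (gramDet p (n + 1)) - Real.log (gramDet p n) :=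
      sub_nonneg.2 (Real.log_le_log hpos (gramDet_mono p n.le_succ))
    rw [Finset.sum_Ico_succ_top hn]
    nlinarith [selfNorm_succ_le e hpos, mul_le_mul_of_nonneg_right (hsq n) hlog]

/-- Pairs of consecutive regressors that differ separate the regressors from any constant. -/
lemma sum_sq_pairs_le (p : ℕ → ℝ) (c : ℝ) (m : ℕ) :
    ∑ j ∈ Finset.range m, (p (2 * j) - p (2 * j + 1)) ^ 2 / 2 ≤
      ∑ k ∈ Finset.range (2 * m), (p k - c) ^ 2 := by
  induction m with
  | zero => simp
  | succ m ih =>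
    rw [Finset.sum_range_succ, show 2 * (m + 1) = 2 * m + 1 + 1 by ring, Finset.sum_range_succ,
      Finset.sum_range_succ]
    nlinarith [sq_nonneg (p (2 * m) - c + (p (2 * m + 1) - c))]

lemma gramDet_eq (p : ℕ → ℝ) {n : ℕ} (hn : n ≠ 0) :
    gramDet p n =
      n * ∑ k ∈ Finset.range n, (p k - (∑ k ∈ Finset.range n, p k) / n) ^ 2 := by
  have hn' : (n : ℝ) ≠ 0 := Nat.cast_ne_zero.2 hn
  set c := (∑ k ∈ Finset.range n, p k) / n with hc
  have h : ∑ k ∈ Finset.range n, (p k - c) ^ 2 = ∑ k ∈ Finset.range n, p k ^ 2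
      - 2 * c * ∑ k ∈ Finset.range n, p k + n * c ^ 2 := by
    simp only [sub_sq, Finset.sum_add_distrib, Finset.sum_sub_distrib, Finset.sum_const,
      Finset.card_range, nsmul_eq_mul, Finset.mul_sum]
    congr 2
    exact Finset.sum_congr rfl fun k _ => by ring
  have hB : ∑ k ∈ Finset.range n, p k = n * c := by rw [hc]; field_simp
  rw [h, gramDet, hB]
  ring

/-- If the prices of each pair of days differ by at least `δ`, the Gram determinant is at least
quadratic in the number of days. -/
lemma gramDet_ge {p : ℕ → ℝ} {δ : ℝ} (hδ : 0 ≤ δ) {m : ℕ}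
    (h : ∀ j < m, δ ≤ p (2 * j) - p (2 * j + 1)) :
    ((2 * m : ℕ) : ℝ) ^ 2 * δ ^ 2 / 4 ≤ gramDet p (2 * m) := by
  rcases Nat.eq_zero_or_pos m with rfl | hm
  · simp [gramDet]
  rw [gramDet_eq p (by omega)]
  have h1 : ∑ j ∈ Finset.range m, δ ^ 2 / 2 ≤
      ∑ j ∈ Finset.range m, (p (2 * j) - p (2 * j + 1)) ^ 2 / 2 :=
    Finset.sum_le_sum fun j hj => by
      have := h j (Finset.mem_range.1 hj)
      gcongr
  have h2 := h1.trans (sum_sq_pairs_le p ((∑ k ∈ Finset.range (2 * m), p k) / (2 * m : ℕ)) m)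
  rw [Finset.sum_const, Finset.card_range, nsmul_eq_mul] at h2
  have h3 := mul_le_mul_of_nonneg_left h2 (Nat.cast_nonneg (α := ℝ) (2 * m))
  refine le_trans (le_of_eq ?_) h3
  push_cast
  ring

/-- The closed form of the least squares fit of `y k ≈ a - b * p k`, `k < n`. -/
def fitSlope (p y : ℕ → ℝ) (n : ℕ) : ℝ :=
  ((∑ k ∈ Finset.range n, p k) * (∑ k ∈ Finset.range n, y k)
    - n * ∑ k ∈ Finset.range n, y k * p k) / gramDet p n

/-- The closed form of the intercept of the least squares fit. -/
def fitIntercept (p y : ℕ → ℝ) (n : ℕ) : ℝ :=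
  (∑ k ∈ Finset.range n, y k + fitSlope p y n * ∑ k ∈ Finset.range n, p k) / n

lemma sum_residual_sq (p y : ℕ → ℝ) (a b : ℝ) (n : ℕ) :
    ∑ k ∈ Finset.range n, (y k - (a - b * p k)) ^ 2 =
      ∑ k ∈ Finset.range n, y k ^ 2 - 2 * a * ∑ k ∈ Finset.range n, y k
        + 2 * b * ∑ k ∈ Finset.range n, y k * p k + n * a ^ 2
        - 2 * a * b * ∑ k ∈ Finset.range n, p k + b ^ 2 * ∑ k ∈ Finset.range n, p k ^ 2 := by
  induction n with
  | zero => simp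
  | succ n ih =>
    simp only [Finset.sum_range_succ, ih]
    push_cast
    ring

/-- Completing the square around the closed form. The two added terms are nonnegative and vanish
only at the fit, which yields both existence and uniqueness of the minimizer. -/
lemma sum_residual_sq_eq {p : ℕ → ℝ} (y : ℕ → ℝ) (a b : ℝ) {n : ℕ} (h : 0 < gramDet p n) :
    ∑ k ∈ Finset.range n, (y k - (a - b * p k)) ^ 2 =
      ∑ k ∈ Finset.range n, (y k - (fitIntercept p y n - fitSlope p y n * p k)) ^ 2
        + (n * (a - fitIntercept p y n)
            - (b - fitSlope p y n) * ∑ k ∈ Finset.range n, p k) ^ 2 / n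
        + (b - fitSlope p y n) ^ 2 * gramDet p n / n := by
  have hn : (n : ℝ) ≠ 0 := by
    rintro h0
    have : n = 0 := by exact_mod_cast h0
    subst this
    simp [gramDet] at h
  rw [sum_residual_sq, sum_residual_sq]
  have h1 : n * fitIntercept p y n = ∑ k ∈ Finset.range n, y k
      + fitSlope p y n * ∑ k ∈ Finset.range n, p k := by
    rw [fitIntercept]; field_simp
  have h2 : fitSlope p y n * gramDet p n = (∑ k ∈ Finset.range n, p k)
      * (∑ k ∈ Finset.range n, y k) - n * ∑ k ∈ Finset.range n, y k * p k := by
    rw [fitSlope]; field_simp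
  -- The normal equations, solved for the sums that involve `y`, reduce the claim to a polynomial
  -- identity.
  have hY : ∑ k ∈ Finset.range n, y k = n * fitIntercept p y n
      - fitSlope p y n * ∑ k ∈ Finset.range n, p k := by linarith
  have hZ : ∑ k ∈ Finset.range n, y k * p k = ((∑ k ∈ Finset.range n, p k)
      * (∑ k ∈ Finset.range n, y k) - fitSlope p y n * gramDet p n) / n := by
    rw [h2]; field_simp; ring
  rw [hZ, hY]
  have hG : gramDet p n = n * ∑ k ∈ Finset.range n, p k ^ 2
    - (∑ k ∈ Finset.range n, p k) ^ 2 := rfl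
  rw [hG]
  field_simp
  ring

/-- A minimizer of the sum of squared residuals is given by the closed form. -/
lemma eq_fit_of_forall_le {p y : ℕ → ℝ} {n : ℕ} (h : 0 < gramDet p n) {a b : ℝ}
    (hmin : ∑ k ∈ Finset.range n, (y k - (a - b * p k)) ^ 2 ≤
      ∑ k ∈ Finset.range n, (y k - (fitIntercept p y n - fitSlope p y n * p k)) ^ 2) :
    a = fitIntercept p y n ∧ b = fitSlope p y n := by
  have hn : (0 : ℝ) < n := by
    rcases Nat.eq_zero_or_pos n with rfl | h0
    · simp [gramDet] at h
    · exact_mod_cast h0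
  rw [sum_residual_sq_eq y a b h] at hmin
  have h1 : 0 ≤ (n * (a - fitIntercept p y n)
      - (b - fitSlope p y n) * ∑ k ∈ Finset.range n, p k) ^ 2 / n := by positivity
  have h2 : 0 ≤ (b - fitSlope p y n) ^ 2 * gramDet p n / n := by positivity
  have hb : (b - fitSlope p y n) ^ 2 * gramDet p n / n = 0 := by linarith
  have hb' : b - fitSlope p y n = 0 := by
    simpa [hn.ne', h.ne'] using hb
  have ha : (n * (a - fitIntercept p y n)
      - (b - fitSlope p y n) * ∑ k ∈ Finset.range n, p k) ^ 2 / n = 0 := by linarith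
  rw [hb'] at ha
  have ha' : a - fitIntercept p y n = 0 := by simpa [hn.ne'] using ha
  exact ⟨by linarith, by linarith⟩

section Error

variable {p y e : ℕ → ℝ} {α β : ℝ} {n : ℕ}

lemma fitSlope_sub (hy : ∀ k < n, y k = α - β * p k + e k) (h : 0 < gramDet p n) :
    fitSlope p y n - β = ((∑ k ∈ Finset.range n, p k) * (∑ k ∈ Finset.range n, e k)
      - n * ∑ k ∈ Finset.range n, e k * p k) / gramDet p n := by
  have h1 : ∑ k ∈ Finset.range n, y k = n * α - β * ∑ k ∈ Finset.range n, p k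
      + ∑ k ∈ Finset.range n, e k := by
    rw [Finset.sum_congr rfl fun k hk => hy k (Finset.mem_range.1 hk)]
    simp [Finset.sum_add_distrib, Finset.mul_sum]
  have h2 : ∑ k ∈ Finset.range n, y k * p k = α * ∑ k ∈ Finset.range n, p k
      - β * ∑ k ∈ Finset.range n, p k ^ 2 + ∑ k ∈ Finset.range n, e k * p k := by
    rw [Finset.sum_congr rfl fun k hk => by rw [hy k (Finset.mem_range.1 hk)]]
    simp only [Finset.mul_sum, ← Finset.sum_sub_distrib, ← Finset.sum_add_distrib]
    exact Finset.sum_congr rfl fun k _ => by ring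
  rw [fitSlope, h1, h2, eq_div_iff h.ne', sub_mul, div_mul_cancel₀ _ h.ne', gramDet]
  ring

lemma fitIntercept_sub (hy : ∀ k < n, y k = α - β * p k + e k) (h : 0 < gramDet p n) :
    fitIntercept p y n - α = (∑ k ∈ Finset.range n, e k) / n
      + (fitSlope p y n - β) * ((∑ k ∈ Finset.range n, p k) / n) := by
  have hn : (n : ℝ) ≠ 0 := by
    rintro h0
    have : n = 0 := by exact_mod_cast h0
    subst this
    simp [gramDet] at h
  have h1 : ∑ k ∈ Finset.range n, y k = n * α - β * ∑ k ∈ Finset.range n, p k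
      + ∑ k ∈ Finset.range n, e k := by
    rw [Finset.sum_congr rfl fun k hk => hy k (Finset.mem_range.1 hk)]
    simp [Finset.sum_add_distrib, Finset.mul_sum]
  rw [fitIntercept, h1]
  field_simp
  ring

/-- `selfNorm` is the sum of the squared errors of the fitted slope and of the mean, weighted by
the respective information. -/
lemma selfNorm_eq (hy : ∀ k < n, y k = α - β * p k + e k) (h : 0 < gramDet p n) :
    selfNorm p e n = (∑ k ∈ Finset.range n, e k) ^ 2 / n
      + (fitSlope p y n - β) ^ 2 * (gramDet p n / n) := by
  have hn : (n : ℝ) ≠ 0 := by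
    rintro h0
    have : n = 0 := by exact_mod_cast h0
    subst this
    simp [gramDet] at h
  rw [fitSlope_sub hy h, selfNorm]
  have hG : ∑ k ∈ Finset.range n, p k ^ 2
    = (gramDet p n + (∑ k ∈ Finset.range n, p k) ^ 2) / n := by
    rw [gramDet]; field_simp; ring
  rw [hG]
  field_simp
  ring

/-- The total estimation error in terms of `selfNorm` and the spread of the prices. -/
lemma fit_error_le {b δ : ℝ} (hy : ∀ k < n, y k = α - β * p k + e k) (h : 0 < gramDet p n)
    (hp : ∀ k < n, |p k| ≤ b) (hδ : 0 < δ) (hdet : (n : ℝ) ^ 2 * δ ^ 2 / 4 ≤ gramDet p n) :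
    |fitIntercept p y n - α| + |fitSlope p y n - β| ≤
      (1 + 2 * (1 + b) / δ) * Real.sqrt (selfNorm p e n / n) := by
  have hn : (0 : ℝ) < n := by
    rcases Nat.eq_zero_or_pos n with rfl | h0
    · simp [gramDet] at h
    · exact_mod_cast h0
  have hb : 0 ≤ b := (abs_nonneg _).trans (hp 0 (by exact_mod_cast hn))
  have hQ := selfNorm_eq hy h
  -- Both summands in `selfNorm_eq` are nonnegative, so each is at most `selfNorm`. The first
  -- controls the mean of the noise; the second controls the slope error, since `gramDet p n / n ≥ n
  -- * δ ^ 2 / 4`.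
  have hmean : |(∑ k ∈ Finset.range n, e k) / n| ≤ Real.sqrt (selfNorm p e n / n) := by
    apply Real.abs_le_sqrt
    have : 0 ≤ (fitSlope p y n - β) ^ 2 * (gramDet p n / n) := by positivity
    rw [div_pow, le_div_iff₀ hn, hQ]
    refine le_trans (le_of_eq ?_) (le_add_of_nonneg_right this)
    field_simp
  have hslope : |fitSlope p y n - β| ≤ 2 / δ * Real.sqrt (selfNorm p e n / n) := by
    have h1 : (fitSlope p y n - β) ^ 2 * (n * δ ^ 2 / 4) ≤ selfNorm p e n := by
      rw [hQ]
      have h2 : n * δ ^ 2 / 4 ≤ gramDet p n / n := by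
        rw [le_div_iff₀ hn]
        linarith
      have h3 : 0 ≤ (∑ k ∈ Finset.range n, e k) ^ 2 / n := by positivity
      have := mul_le_mul_of_nonneg_left h2 (sq_nonneg (fitSlope p y n - β))
      linarith
    have h2 : |(fitSlope p y n - β) * (δ / 2)| ≤ Real.sqrt (selfNorm p e n / n) := by
      apply Real.abs_le_sqrt
      rw [le_div_iff₀ hn]
      linarith
    rw [abs_mul, abs_of_pos (by positivity : 0 < δ / 2)] at h2
    have := mul_le_mul_of_nonneg_left h2 (by positivity : 0 ≤ 2 / δ)
    refine le_trans (le_of_eq ?_) this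
    field_simp
  have hbar : |(∑ k ∈ Finset.range n, p k) / n| ≤ b := by
    rw [abs_div, abs_of_pos hn, div_le_iff₀ hn]
    calc _ ≤ ∑ k ∈ Finset.range n, |p k| := Finset.abs_sum_le_sum_abs _ _
      _ ≤ ∑ k ∈ Finset.range n, b :=
          Finset.sum_le_sum fun k hk => hp k (Finset.mem_range.1 hk)
      _ = b * n := by simp [mul_comm]
  have hint : |fitIntercept p y n - α| ≤ Real.sqrt (selfNorm p e n / n)
      + |fitSlope p y n - β| * b := by
    rw [fitIntercept_sub hy h]
    refine (abs_add_le _ _).trans (add_le_add hmean ?_)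
    rw [abs_mul]
    exact mul_le_mul_of_nonneg_left hbar (abs_nonneg _)
  have := mul_le_mul_of_nonneg_right hslope (by positivity : 0 ≤ 1 + b)
  calc _ ≤ Real.sqrt (selfNorm p e n / n) + |fitSlope p y n - β| * (1 + b) := by linarith
    _ ≤ _ := by
      refine (add_le_add_right this _).trans (le_of_eq ?_)
      ring

end Error

end NRPS

end

/-! ### The KKT system: bounds and Lipschitz dependence on the parameters. -/

noncomputable section

namespace NRPS

variable {N : ℕ}

/-- Balanced flows are orthogonal to potential differences. -/
lemma FlowBalance.sum_mul_eq_zero {w : Link N → ℝ} (h : FlowBalance w) (σ : Fin N → ℝ) :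
    ∑ l, w l * (σ l.1.1 - σ l.1.2) = 0 := by
  have h1 : ∑ l : Link N, w l * σ l.1.1 =
      ∑ i, (∑ l ∈ Finset.univ.filter (fun l : Link N => l.1.1 = i), w l) * σ i := by
    rw [← Finset.sum_fiberwise Finset.univ (fun l : Link N => l.1.1)]
    refine Finset.sum_congr rfl fun i _ => ?_
    rw [Finset.sum_mul]
    exact Finset.sum_congr rfl fun l hl => by rw [(Finset.mem_filter.1 hl).2]
  have h2 : ∑ l : Link N, w l * σ l.1.2 =
      ∑ i, (∑ l ∈ Finset.univ.filter (fun l : Link N => l.1.2 = i), w l) * σ i := by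
    rw [← Finset.sum_fiberwise Finset.univ (fun l : Link N => l.1.2)]
    refine Finset.sum_congr rfl fun i _ => ?_
    rw [Finset.sum_mul]
    exact Finset.sum_congr rfl fun l hl => by rw [(Finset.mem_filter.1 hl).2]
  simp only [mul_sub, Finset.sum_sub_distrib]
  rw [h1, h2, sub_eq_zero]
  exact Finset.sum_congr rfl fun i _ => by rw [h i]

/-- The `ℓ¹` distance between two parameter vectors. -/
def paramDist (θ θ' : Params N) : ℝ :=
  ∑ l, (|(θ l).1 - (θ' l).1| + |(θ l).2 - (θ' l).2|)

lemma paramDist_nonneg (θ θ' : Params N) : 0 ≤ paramDist θ θ' :=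
  Finset.sum_nonneg fun _ _ => by positivity

lemma le_paramDist (θ θ' : Params N) (l : Link N) :
    |(θ l).1 - (θ' l).1| + |(θ l).2 - (θ' l).2| ≤ paramDist θ θ' :=
  Finset.single_le_sum (f := fun l => |(θ l).1 - (θ' l).1| + |(θ l).2 - (θ' l).2|)
    (fun _ _ => by positivity) (Finset.mem_univ l)

/-- Cauchy–Schwarz bounds `(∑ |δ|)²` by the number of terms times the energy; one factor `∑ |δ|`
then cancels. -/
lemma sum_abs_le_of_energy {ι : Type*} [Fintype ι] {δ : ι → ℝ} {κ R : ℝ} (hκ : 0 < κ)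
    (hR : 0 ≤ R) (h : κ * ∑ l, δ l ^ 2 ≤ R * ∑ l, |δ l|) (l : ι) :
    |δ l| ≤ Fintype.card ι * R / κ := by
  have hT : |δ l| ≤ ∑ l, |δ l| :=
    Finset.single_le_sum (f := fun l => |δ l|) (fun _ _ => abs_nonneg _) (Finset.mem_univ l)
  refine hT.trans ?_
  rw [le_div_iff₀ hκ]
  have hcs : (∑ l, |δ l|) ^ 2 ≤ Fintype.card ι * ∑ l, δ l ^ 2 := by
    have := sq_sum_le_card_mul_sum_sq (s := Finset.univ) (f := fun l => |δ l|)
    simpa [sq_abs] using this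
  rcases (Finset.sum_nonneg fun l _ => abs_nonneg (δ l) :
    0 ≤ ∑ l ∈ Finset.univ, |δ l|).eq_or_lt with h0 | h0
  · rw [← h0]
    simp only [zero_mul]
    positivity
  · have h1 := mul_le_mul_of_nonneg_left h (Nat.cast_nonneg (α := ℝ) (Fintype.card ι))
    have h2 := mul_le_mul_of_nonneg_left hcs hκ.le
    refine le_of_mul_le_mul_right ?_ h0
    nlinarith

namespace Market

variable {M : Market N} {F : Link N → Measure ℝ} {θ θ' : Params N} {p p' : Link N → ℝ}
  {σ σ' : Fin N → ℝ}

lemma pmax_pos (M : Market N) : 0 < M.pmax := M.c_pos.trans M.c_lt_pmax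

lemma InBox.slope_pos (h : M.InBox θ) (l : Link N) : 0 < (θ l).2 :=
  M.βmin_pos.trans_le (h l).2.1

/-- Without cap multipliers, stationarity is a linear equation in the single price of each link; the
links interact only through the potentials. -/
lemma IsKKT.price_eq (h : M.IsKKT F θ p σ 0) (hθ : M.InBox θ) (l : Link N) :
    p l = ((θ l).1 + negPart (F l)) / (2 * (θ l).2) + M.c / 2
      + (σ l.1.1 - σ l.1.2) / (2 * M.ξ l) := by
  have h1 := h.stationary l
  have hβ := (hθ.slope_pos l).ne'
  have hξ := (M.ξ_pos l).ne'
  simp only [Pi.zero_apply, add_zero] at h1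
  field_simp
  linarith

lemma IsKKT.supply_eq (h : M.IsKKT F θ p σ 0) (hθ : M.InBox θ) (l : Link N) :
    (θ l).1 - (θ l).2 * p l = ((θ l).1 - negPart (F l) - (θ l).2 * M.c) / 2
      - (θ l).2 / (2 * M.ξ l) * (σ l.1.1 - σ l.1.2) := by
  have hβ := (hθ.slope_pos l).ne'
  have hξ := (M.ξ_pos l).ne'
  rw [h.price_eq hθ l]
  field_simp
  ring

/-- A common upper bound for the travel times. -/
def timeBound (M : Market N) : ℝ := 1 + ∑ l, M.ξ l

lemma timeBound_pos (M : Market N) : 0 < M.timeBound := by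
  have : 0 ≤ ∑ l, M.ξ l := Finset.sum_nonneg fun l _ => (M.ξ_pos l).le
  unfold timeBound
  linarith

lemma le_timeBound (M : Market N) (l : Link N) : M.ξ l ≤ M.timeBound := by
  have : M.ξ l ≤ ∑ l, M.ξ l :=
    Finset.single_le_sum (f := M.ξ) (fun l _ => (M.ξ_pos l).le) (Finset.mem_univ l)
  unfold timeBound
  linarith

/-- A common upper bound for the reciprocals of the travel times. -/
def invTimeBound (M : Market N) : ℝ := 1 + ∑ l, (M.ξ l)⁻¹

lemma invTimeBound_pos (M : Market N) : 0 < M.invTimeBound := by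
  have : 0 ≤ ∑ l, (M.ξ l)⁻¹ := Finset.sum_nonneg fun l _ => (inv_pos.2 (M.ξ_pos l)).le
  unfold invTimeBound
  linarith

lemma inv_le_invTimeBound (M : Market N) (l : Link N) : (M.ξ l)⁻¹ ≤ M.invTimeBound := by
  have : (M.ξ l)⁻¹ ≤ ∑ l, (M.ξ l)⁻¹ :=
    Finset.single_le_sum (f := fun l => (M.ξ l)⁻¹) (fun l _ => (inv_pos.2 (M.ξ_pos l)).le)
      (Finset.mem_univ l)
  unfold invTimeBound
  linarith

/-- A lower bound for the curvatures `β / (2 ξ)` of the dual problem. -/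
def curvature (M : Market N) : ℝ := M.βmin / (2 * M.timeBound)

lemma curvature_pos (M : Market N) : 0 < M.curvature :=
  div_pos M.βmin_pos (mul_pos two_pos M.timeBound_pos)

lemma InBox.curvature_le (h : M.InBox θ) (l : Link N) : M.curvature ≤ (θ l).2 / (2 * M.ξ l) := by
  have := M.ξ_pos l
  exact div_le_div₀ (h.slope_pos l).le (h l).2.1 (by positivity)
    (by linarith [M.le_timeBound l])

/-- A common upper bound for the primitives of the market. -/
def size (M : Market N) : ℝ := 1 + |M.αmax| + |M.εlo| + |M.εhi| + |M.βmax| + M.c + M.pmax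

lemma one_le_size (M : Market N) : 1 ≤ M.size := by
  have := M.pmax_pos
  have := M.c_pos
  unfold size
  have := abs_nonneg M.αmax
  have := abs_nonneg M.βmax
  have := abs_nonneg M.εlo
  have := abs_nonneg M.εhi
  linarith

lemma InBox.abs_intercept_le (h : M.InBox θ) (l : Link N) : |(θ l).1| ≤ |M.αmax| := by
  have h1 := (h l).1
  have := M.αmin_pos
  rw [abs_of_pos (by linarith [h1.1])]
  exact h1.2.trans (le_abs_self _)

lemma InBox.abs_slope_le (h : M.InBox θ) (l : Link N) : |(θ l).2| ≤ |M.βmax| := by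
  rw [abs_of_pos (h.slope_pos l)]
  exact (h l).2.2.trans (le_abs_self _)

lemma abs_negPart_le (hF : ∀ l, negPart (F l) ∈ Set.Icc M.εlo 0) (l : Link N) :
    |negPart (F l)| ≤ |M.εlo| := by
  have := hF l
  rw [abs_of_nonpos this.2, abs_of_nonpos (this.1.trans this.2)]
  linarith [this.1]

/-- A bound for the potential differences in the solutions of the KKT conditions. -/
def dualBound (M : Market N) : ℝ :=
  Fintype.card (Link N) * (M.size + M.size ^ 2) / M.curvature

lemma dualBound_nonneg (M : Market N) : 0 ≤ M.dualBound := by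
  have := M.curvature_pos
  have := M.one_le_size
  unfold dualBound
  positivity

lemma IsKKT.abs_dual_le (hF : ∀ l, negPart (F l) ∈ Set.Icc M.εlo 0) (hθ : M.InBox θ)
    (h : M.IsKKT F θ p σ 0) (l : Link N) : |σ l.1.1 - σ l.1.2| ≤ M.dualBound := by
  have h1 := M.one_le_size
  refine sum_abs_le_of_energy (δ := fun l : Link N => σ l.1.1 - σ l.1.2) M.curvature_pos
    (by positivity) ?_ l
  have h0 := h.balance.sum_mul_eq_zero σ
  -- The balance equation tested with `σ` itself: the quadratic part of the flow is the energy, the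
  -- affine part the right-hand side.
  have hsum : ∑ l : Link N, (θ l).2 / (2 * M.ξ l) * (σ l.1.1 - σ l.1.2) ^ 2 =
      ∑ l : Link N, ((θ l).1 - negPart (F l) - (θ l).2 * M.c) / 2 * (σ l.1.1 - σ l.1.2) := by
    rw [← sub_eq_zero, ← Finset.sum_sub_distrib, ← neg_eq_zero, ← Finset.sum_neg_distrib]
    rw [← h0]
    refine Finset.sum_congr rfl fun l _ => ?_
    rw [h.supply_eq hθ l]
    ring
  calc M.curvature * ∑ l : Link N, (σ l.1.1 - σ l.1.2) ^ 2
      ≤ ∑ l : Link N, (θ l).2 / (2 * M.ξ l) * (σ l.1.1 - σ l.1.2) ^ 2 := by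
        rw [Finset.mul_sum]
        exact Finset.sum_le_sum fun l _ =>
          mul_le_mul_of_nonneg_right (hθ.curvature_le l) (sq_nonneg _)
    _ = _ := hsum
    _ ≤ _ := by
        rw [Finset.mul_sum]
        refine Finset.sum_le_sum fun l _ => ?_
        refine (le_abs_self _).trans ?_
        rw [abs_mul]
        refine mul_le_mul_of_nonneg_right ?_ (abs_nonneg _)
        have ha := hθ.abs_intercept_le l
        have hn := abs_negPart_le hF l
        have hb := hθ.abs_slope_le l
        have hc := M.c_pos
        have hbc : |(θ l).2 * M.c| ≤ M.size ^ 2 := by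
          rw [abs_mul, abs_of_pos hc, sq]
          refine mul_le_mul ?_ ?_ hc.le (by positivity)
          all_goals
            have := abs_nonneg M.αmax
            have := abs_nonneg M.εlo
            have := abs_nonneg M.εhi
            have := abs_nonneg M.βmax
            have := M.pmax_pos
            unfold size
            linarith
        have hs : |(θ l).1| + |negPart (F l)| ≤ M.size := by
          have := abs_nonneg M.βmax
          have := abs_nonneg M.εhi
          have := M.pmax_pos
          unfold size
          linarith
        rw [abs_div, abs_two]
        have := abs_sub ((θ l).1 - negPart (F l)) ((θ l).2 * M.c)
        have := abs_sub (θ l).1 (negPart (F l))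
        have : 0 ≤ |(θ l).1 - negPart (F l) - (θ l).2 * M.c| := abs_nonneg _
        linarith

/-- A bound for the prices that satisfy the KKT conditions. -/
def priceBound (M : Market N) : ℝ :=
  M.size / M.βmin + M.size + M.dualBound * M.invTimeBound

lemma priceBound_pos (M : Market N) : 0 < M.priceBound := by
  have := M.one_le_size
  have := M.βmin_pos
  have := M.dualBound_nonneg
  have := M.invTimeBound_pos
  unfold priceBound
  positivity

lemma abs_div_time_le (M : Market N) (l : Link N) {x y : ℝ} (h : |x| ≤ y) :
    |x / (2 * M.ξ l)| ≤ y * M.invTimeBound := by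
  have hξ := M.ξ_pos l
  rw [abs_div, abs_of_pos (by positivity : 0 < 2 * M.ξ l), div_eq_mul_inv]
  refine mul_le_mul h ?_ (by positivity) ((abs_nonneg x).trans h)
  refine le_trans ?_ (M.inv_le_invTimeBound l)
  exact inv_anti₀ hξ (by linarith)

lemma IsKKT.abs_price_le (hF : ∀ l, negPart (F l) ∈ Set.Icc M.εlo 0) (hθ : M.InBox θ)
    (h : M.IsKKT F θ p σ 0) (l : Link N) : |p l| ≤ M.priceBound := by
  rw [h.price_eq hθ l, priceBound]
  have hβ := M.βmin_pos
  have hc := M.c_pos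
  have hs : |(θ l).1 + negPart (F l)| ≤ M.size := by
    have := abs_nonneg M.βmax
    have := abs_nonneg M.εhi
    have := M.pmax_pos
    have := hθ.abs_intercept_le l
    have := abs_negPart_le hF l
    refine (abs_add_le _ _).trans ?_
    unfold size
    linarith
  refine (abs_add_three _ _ _).trans (add_le_add_three ?_ ?_
    (M.abs_div_time_le l (h.abs_dual_le hF hθ l)))
  · rw [abs_div]
    refine div_le_div₀ (by linarith [M.one_le_size]) hs hβ ?_
    have := hθ.slope_pos l
    rw [abs_of_pos (by positivity)]
    linarith [(hθ l).2.1]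
  · rw [abs_of_pos (by positivity)]
    have := abs_nonneg M.αmax
    have := abs_nonneg M.εlo
    have := abs_nonneg M.εhi
    have := abs_nonneg M.βmax
    have := M.pmax_pos
    unfold size
    linarith

/-- A Lipschitz constant for the potential differences as functions of the parameters. -/
def dualLipschitz (M : Market N) : ℝ :=
  Fintype.card (Link N) * (1 + M.size + M.dualBound * M.invTimeBound) / M.curvature

lemma dualLipschitz_nonneg (M : Market N) : 0 ≤ M.dualLipschitz := by
  have := M.one_le_size
  have := M.curvature_pos
  have := M.dualBound_nonneg
  have := M.invTimeBound_pos
  unfold dualLipschitz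
  positivity

/-- The difference of the two balance equations is tested with the difference of the potentials. The
weights of `θ'` stay on the left; the change of weights multiplies the first potential, which
`abs_dual_le` bounds. The term `negPart` cancels because the shock law is the same. -/
lemma IsKKT.abs_dual_sub_le (hF : ∀ l, negPart (F l) ∈ Set.Icc M.εlo 0) (hθ : M.InBox θ)
    (hθ' : M.InBox θ') (h : M.IsKKT F θ p σ 0) (h' : M.IsKKT F θ' p' σ' 0) (l : Link N) :
    |(σ l.1.1 - σ l.1.2) - (σ' l.1.1 - σ' l.1.2)| ≤ M.dualLipschitz * paramDist θ θ' := by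
  have h1 := M.one_le_size
  have h2 := M.dualBound_nonneg
  have h3 := M.invTimeBound_pos
  have h4 := paramDist_nonneg θ θ'
  have key := sum_abs_le_of_energy
    (δ := fun l : Link N => (σ l.1.1 - σ l.1.2) - (σ' l.1.1 - σ' l.1.2)) M.curvature_pos
    (R := (1 + M.size + M.dualBound * M.invTimeBound) * paramDist θ θ') (by positivity) ?_ l
  · refine key.trans (le_of_eq ?_)
    rw [dualLipschitz]
    ring
  have e1 := h.balance.sum_mul_eq_zero σ
  have e2 := h.balance.sum_mul_eq_zero σ'
  have e3 := h'.balance.sum_mul_eq_zero σ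
  have e4 := h'.balance.sum_mul_eq_zero σ'
  have hsum : ∑ l : Link N, (θ' l).2 / (2 * M.ξ l)
        * ((σ l.1.1 - σ l.1.2) - (σ' l.1.1 - σ' l.1.2)) ^ 2 =
      ∑ l : Link N, (((θ l).1 - (θ' l).1) / 2 - ((θ l).2 - (θ' l).2) * (M.c / 2)
        - ((θ l).2 - (θ' l).2) * ((σ l.1.1 - σ l.1.2) / (2 * M.ξ l)))
        * ((σ l.1.1 - σ l.1.2) - (σ' l.1.1 - σ' l.1.2)) := by
    have e5 : ∑ l : Link N, (((θ l).1 - (θ l).2 * p l) - ((θ' l).1 - (θ' l).2 * p' l))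
        * ((σ l.1.1 - σ l.1.2) - (σ' l.1.1 - σ' l.1.2)) = 0 := by
      simp only [sub_mul _ (_ - (θ' _).2 * _), mul_sub (_ - (_ : ℝ) * _) (σ _ - σ _),
        Finset.sum_sub_distrib, e1, e2, e3, e4]
      simp
    rw [← sub_eq_zero, ← Finset.sum_sub_distrib, ← neg_eq_zero, ← Finset.sum_neg_distrib, ← e5]
    refine Finset.sum_congr rfl fun l _ => ?_
    rw [h.supply_eq hθ l, h'.supply_eq hθ' l]
    have := (M.ξ_pos l).ne'
    field_simp
    ring
  calc _ ≤ ∑ l : Link N, (θ' l).2 / (2 * M.ξ l)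
        * ((σ l.1.1 - σ l.1.2) - (σ' l.1.1 - σ' l.1.2)) ^ 2 := by
        rw [Finset.mul_sum]
        exact Finset.sum_le_sum fun l _ =>
          mul_le_mul_of_nonneg_right (hθ'.curvature_le l) (sq_nonneg _)
    _ = _ := hsum
    _ ≤ _ := by
        rw [Finset.mul_sum]
        refine Finset.sum_le_sum fun l _ => ?_
        refine (le_abs_self _).trans ?_
        rw [abs_mul]
        refine mul_le_mul_of_nonneg_right ?_ (abs_nonneg _)
        have hd := le_paramDist θ θ' l
        have ha := abs_nonneg ((θ l).1 - (θ' l).1)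
        have hb := abs_nonneg ((θ l).2 - (θ' l).2)
        have hc : |M.c / 2| ≤ M.size := by
          have hc := M.c_pos
          rw [abs_of_pos (by positivity)]
          have := abs_nonneg M.αmax
          have := abs_nonneg M.εlo
          have := abs_nonneg M.εhi
          have := abs_nonneg M.βmax
          have := M.pmax_pos
          unfold size
          linarith
        have hδ := M.abs_div_time_le l (h.abs_dual_le hF hθ l)
        refine (abs_sub _ _).trans ((add_le_add_left (abs_sub _ _) _).trans ?_)
        rw [abs_div, abs_two, abs_mul, abs_mul, add_mul, add_mul, one_mul]
        refine add_le_add_three (by linarith) ?_ ?_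
        · rw [mul_comm]
          exact mul_le_mul hc (by linarith) hb (by linarith)
        · rw [mul_comm]
          exact mul_le_mul hδ (by linarith) hb (by positivity)

/-- A Lipschitz constant for the optimal prices as functions of the parameters. -/
def priceLipschitz (M : Market N) : ℝ :=
  M.size / M.βmin ^ 2 + 1 / M.βmin + M.dualLipschitz * M.invTimeBound

lemma priceLipschitz_nonneg (M : Market N) : 0 ≤ M.priceLipschitz := by
  have := M.one_le_size
  have := M.βmin_pos
  have := M.dualLipschitz_nonneg
  have := M.invTimeBound_pos
  unfold priceLipschitz
  positivity

lemma IsKKT.abs_price_sub_le (hF : ∀ l, negPart (F l) ∈ Set.Icc M.εlo 0) (hθ : M.InBox θ)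
    (hθ' : M.InBox θ') (h : M.IsKKT F θ p σ 0) (h' : M.IsKKT F θ' p' σ' 0) (l : Link N) :
    |p l - p' l| ≤ M.priceLipschitz * paramDist θ θ' := by
  have hβ := M.βmin_pos
  have hb := hθ.slope_pos l
  have hb' := hθ'.slope_pos l
  have hξ := M.ξ_pos l
  have hs : |(θ l).1 + negPart (F l)| ≤ M.size := by
    have := abs_nonneg M.βmax
    have := abs_nonneg M.εhi
    have := M.pmax_pos
    have := M.c_pos
    have := hθ.abs_intercept_le l
    have := abs_negPart_le hF l
    refine (abs_add_le _ _).trans ?_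
    unfold size
    linarith
  have heq : p l - p' l = ((θ l).1 + negPart (F l)) / (2 * ((θ l).2 * (θ' l).2))
        * (-((θ l).2 - (θ' l).2)) + ((θ l).1 - (θ' l).1) / (2 * (θ' l).2)
      + ((σ l.1.1 - σ l.1.2) - (σ' l.1.1 - σ' l.1.2)) / (2 * M.ξ l) := by
    rw [h.price_eq hθ l, h'.price_eq hθ' l]
    field_simp
    ring
  have hd := le_paramDist θ θ' l
  have ha0 := abs_nonneg ((θ l).1 - (θ' l).1)
  have hb0 := abs_nonneg ((θ l).2 - (θ' l).2)
  rw [heq, priceLipschitz, add_mul, add_mul]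
  refine (abs_add_three _ _ _).trans (add_le_add_three ?_ ?_ ?_)
  · rw [abs_mul, abs_neg]
    refine mul_le_mul ?_ (by linarith) hb0 (by have := M.one_le_size; positivity)
    rw [abs_div, abs_of_pos (by positivity : 0 < 2 * ((θ l).2 * (θ' l).2))]
    refine div_le_div₀ (by linarith [M.one_le_size]) hs (by positivity) ?_
    have := mul_le_mul (hθ l).2.1 (hθ' l).2.1 hβ.le hb.le
    nlinarith
  · rw [abs_div, abs_of_pos (by positivity : 0 < 2 * (θ' l).2), div_eq_inv_mul, one_div]
    refine mul_le_mul ?_ (by linarith) ha0 (by positivity)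
    exact inv_anti₀ hβ (by linarith [(hθ' l).2.1])
  · refine (M.abs_div_time_le l (h.abs_dual_sub_le hF hθ hθ' h' l)).trans (le_of_eq ?_)
    ring

section Law

variable [∀ l, IsProbabilityMeasure (F l)]

lemma integrable_id_law (hF : ∀ l, ∀ᵐ s ∂(F l), s ∈ Set.Icc M.εlo M.εhi) (l : Link N) :
    Integrable (fun s : ℝ => s) (F l) :=
  Integrable.of_mem_Icc M.εlo M.εhi aemeasurable_id (hF l)

lemma integral_min_zero (G : Measure ℝ) : ∫ s, min s 0 ∂G = negPart G := by
  rw [negPart, ← integral_indicator measurableSet_Iic]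
  refine integral_congr_ae (Filter.Eventually.of_forall fun s => ?_)
  by_cases h : s ≤ 0
  · simp [h]
  · simp [h, (not_le.1 h).le]

lemma negPart_mem (hF : ∀ l, ∀ᵐ s ∂(F l), s ∈ Set.Icc M.εlo M.εhi)
    (h0 : ∀ l, ∫ s, s ∂(F l) = 0) (l : Link N) :
    negPart (F l) ∈ Set.Icc M.εlo 0 ∧ M.εlo ≤ 0 := by
  have hint := M.integrable_id_law hF l
  have hlo : M.εlo ≤ 0 := by
    rw [← h0 l]
    calc M.εlo = ∫ _, M.εlo ∂(F l) := by simp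
      _ ≤ _ := integral_mono_ae (integrable_const _) hint ((hF l).mono fun s hs => hs.1)
  refine ⟨⟨?_, ?_⟩, hlo⟩
  · rw [← integral_min_zero]
    calc M.εlo = ∫ _, M.εlo ∂(F l) := by simp
      _ ≤ _ := integral_mono_ae (integrable_const _) (hint.inf (integrable_const 0))
        ((hF l).mono fun s hs => le_min hs.1 hlo)
  · rw [← integral_min_zero]
    exact integral_nonpos fun s => min_le_right _ _

/-- Local balance turns `min (w + s) w` into `w + min s 0`, so on feasible decisions the objective
is quadratic in the prices. -/
lemma expectedPayoff_eq (hF : ∀ l, ∀ᵐ s ∂(F l), s ∈ Set.Icc M.εlo M.εhi) {x : Decision N}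
    (hx : M.Feasible θ x) : M.expectedPayoff F θ x =
      ∑ l, (M.ξ l * ((θ l).1 - (θ l).2 * x.price l + negPart (F l)) * x.price l
        - M.ξ l * ((θ l).1 - (θ l).2 * x.price l) * M.c) := by
  rw [expectedPayoff, ← Finset.sum_sub_distrib]
  refine Finset.sum_congr rfl fun l _ => ?_
  have : ∫ s, min ((θ l).1 - (θ l).2 * x.price l + s) (x.supply l) ∂(F l) =
      (θ l).1 - (θ l).2 * x.price l + negPart (F l) := by
    rw [hx.local_balance l, ← integral_min_zero]
    have hi : Integrable (fun s : ℝ => min s 0) (F l) :=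
      (M.integrable_id_law hF l).inf (integrable_const 0)
    have hc : ∀ s : ℝ, min ((θ l).1 - (θ l).2 * x.price l + s) ((θ l).1 - (θ l).2 * x.price l) =
        (θ l).1 - (θ l).2 * x.price l + min s 0 := fun s => by
      simpa using min_add_add_left ((θ l).1 - (θ l).2 * x.price l) s 0
    simp only [hc]
    rw [integral_add (integrable_const _) hi]
    simp
  rw [this, hx.local_balance l]

lemma InBox.demand_nonneg (hlo : M.εlo ≤ 0) (hθ : M.InBox θ) {q : ℝ} {l : Link N}
    (hq : q ≤ M.pmax) : 0 ≤ (θ l).1 - (θ l).2 * q := by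
  have h1 := M.demand_nonneg
  have h2 := mul_le_mul_of_nonneg_left hq (hθ.slope_pos l).le
  have h3 := mul_le_mul_of_nonneg_right (hθ l).2.2 M.pmax_pos.le
  linarith [(hθ l).1.1]

/-- The KKT conditions without multipliers of the price caps are sufficient for optimality. -/
lemma IsKKT.isOptimal (hF : ∀ l, ∀ᵐ s ∂(F l), s ∈ Set.Icc M.εlo M.εhi)
    (h0 : ∀ l, ∫ s, s ∂(F l) = 0) (hθ : M.InBox θ) (h : M.IsKKT F θ p σ 0) :
    M.IsOptimal F θ ⟨p, fun l => (θ l).1 - (θ l).2 * p l⟩ := by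
  have hfeas : M.Feasible θ ⟨p, fun l => (θ l).1 - (θ l).2 * p l⟩ :=
    { cap := h.cap
      supply_nonneg := fun l => hθ.demand_nonneg (negPart_mem hF h0 l).2 (h.cap l)
      balance := h.balance
      local_balance := fun l => rfl }
  refine ⟨hfeas, fun y hy => ?_⟩
  rw [expectedPayoff_eq hF hfeas, expectedPayoff_eq hF hy]
  have hbal : FlowBalance fun l => (θ l).1 - (θ l).2 * y.price l := by
    have : y.supply = fun l => (θ l).1 - (θ l).2 * y.price l := funext hy.local_balance
    exact this ▸ hy.balance
  have e1 := h.balance.sum_mul_eq_zero σ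
  have e2 := hbal.sum_mul_eq_zero σ
  rw [← sub_nonneg, ← Finset.sum_sub_distrib]
  -- Flow balance of both decisions makes the first-order term of the objective vanish in total,
  -- although not on each link.
  have e3 : 0 = ∑ l : Link N, (((θ l).1 - (θ l).2 * p l) * (σ l.1.1 - σ l.1.2)
      - ((θ l).1 - (θ l).2 * y.price l) * (σ l.1.1 - σ l.1.2)) := by
    rw [Finset.sum_sub_distrib, e1, e2, sub_zero]
  rw [e3]
  refine Finset.sum_le_sum fun l _ => ?_
  have hs := h.stationary l
  simp only [Pi.zero_apply, add_zero] at hs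
  have hσ : (θ l).2 * (σ l.1.1 - σ l.1.2) = -M.ξ l * ((θ l).1 - (θ l).2 * p l + negPart (F l))
    + M.ξ l * (θ l).2 * p l - M.ξ l * (θ l).2 * M.c := by linarith
  have h1 : ((θ l).1 - (θ l).2 * p l) * (σ l.1.1 - σ l.1.2)
      - ((θ l).1 - (θ l).2 * y.price l) * (σ l.1.1 - σ l.1.2) =
      (y.price l - p l) * (-M.ξ l * ((θ l).1 - (θ l).2 * p l + negPart (F l))
    + M.ξ l * (θ l).2 * p l - M.ξ l * (θ l).2 * M.c) := by
    rw [← hσ]; ring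
  -- The second-order remainder of the concave quadratic objective.
  have h2 : 0 ≤ M.ξ l * (θ l).2 * (y.price l - p l) ^ 2 := by
    have := M.ξ_pos l
    have := hθ.slope_pos l
    positivity
  simp only
  rw [h1]
  linarith

/-- `optimal` is a `Classical.epsilon` choice, so its specification needs some optimal decision to
exist; the KKT point provides one. -/
lemma CapsInactive.feasible_optimal (hF : ∀ l, ∀ᵐ s ∂(F l), s ∈ Set.Icc M.εlo M.εhi)
    (h0 : ∀ l, ∫ s, s ∂(F l) = 0) (hθ : M.InBox θ) (h : M.CapsInactive F θ) :
    M.Feasible θ (M.optimal F θ) := by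
  obtain ⟨σ, hσ⟩ := h
  exact (Classical.epsilon_spec (p := M.IsOptimal F θ) ⟨_, hσ.isOptimal hF h0 hθ⟩).1

end Law


end Market

end NRPS

end

/-! ### The policy along one realization. -/

noncomputable section

namespace NRPS

variable {N : ℕ}

/-- The decision on day `d + 1` under policy `π`. -/
def run (θ : Params N) (π : Policy N) (e : ℕ → Link N → ℝ) (d : ℕ) : Decision N :=
  π d (history θ π e d)

lemma history_apply (θ : Params N) (π : Policy N) (e : ℕ → Link N → ℝ) {d : ℕ} (τ : Fin d) :
    history θ π e d τ =
      { demand := demand θ (run θ π e τ).price (e τ), decision := run θ π e τ } := by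
  induction d with
  | zero => exact τ.elim0
  | succ d ih =>
    refine Fin.lastCases ?_ (fun k => ?_) τ
    · simp [history, run]
    · simp [history, ih]

lemma history_castLE (θ : Params N) (π : Policy N) (e : ℕ → Link N → ℝ) {m d : ℕ} (h : m ≤ d) :
    (fun τ : Fin m => history θ π e d (Fin.castLE h τ)) = history θ π e m := by
  funext τ
  simp [history_apply]

/-- Clipping to an interval is 1-Lipschitz and fixes the points of the interval, so truncation does
not increase the estimation error. -/
lemma abs_max_min_sub_le {x a lo hi : ℝ} (ha : a ∈ Set.Icc lo hi) :
    |max (min x hi) lo - a| ≤ |x - a| := by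
  have h : max (min a hi) lo = a := by rw [min_eq_left ha.2, max_eq_left ha.1]
  calc |max (min x hi) lo - a| = |max (min x hi) lo - max (min a hi) lo| := by rw [h]
    _ ≤ |min x hi - min a hi| := abs_max_sub_max_le_abs _ _ _
    _ ≤ _ := by simpa using abs_min_sub_min_le_max x hi a hi

/-- The closed form is a minimizer, hence the `epsilon` choice is a minimizer too; uniqueness
identifies the two. -/
lemma leastSquares_eq_fit (θ : Params N) (π : Policy N) (e : ℕ → Link N → ℝ) {n : ℕ}
    (l : Link N) (h : 0 < gramDet (fun k => (run θ π e k).price l) n) :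
    leastSquares (history θ π e n) l =
      (fitIntercept (fun k => (run θ π e k).price l)
        (fun k => demand θ (run θ π e k).price (e k) l) n,
       fitSlope (fun k => (run θ π e k).price l)
        (fun k => demand θ (run θ π e k).price (e k) l) n) := by
  set p : ℕ → ℝ := fun k => (run θ π e k).price l
  set y : ℕ → ℝ := fun k => demand θ (run θ π e k).price (e k) l
  have hsum : ∀ ab : ℝ × ℝ, ∑ τ, ((history θ π e n τ).demand l
      - (ab.1 - ab.2 * (history θ π e n τ).decision.price l)) ^ 2 =
      ∑ k ∈ Finset.range n, (y k - (ab.1 - ab.2 * p k)) ^ 2 := fun ab => by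
    rw [Finset.sum_range]
    exact Finset.sum_congr rfl fun τ _ => by rw [history_apply]
  have hmin : IsLeastSquares (history θ π e n) l (fitIntercept p y n, fitSlope p y n) := by
    intro ab
    rw [hsum, hsum, sum_residual_sq_eq y ab.1 ab.2 h, add_assoc]
    refine le_add_of_nonneg_right ?_
    have := h.le
    positivity
  have hspec : IsLeastSquares (history θ π e n) l (leastSquares (history θ π e n) l) :=
    Classical.epsilon_spec ⟨_, hmin⟩
  have := hspec (fitIntercept p y n, fitSlope p y n)
  rw [hsum, hsum] at this
  obtain ⟨h1, h2⟩ := eq_fit_of_forall_le h this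
  exact Prod.ext h1 h2

namespace Market

variable {M : Market N} {F : Link N → Measure ℝ} {θ θ₀ : Params N} {e : ℕ → Link N → ℝ}
  {ρ η : ℝ} {D : ℕ}

/-- The estimate that the policy computes from the first `n` days. -/
def est (M : Market N) (F : Link N → Measure ℝ) (θ : Params N) (ρ η : ℝ) (θ₀ : Params N)
    (e : ℕ → Link N → ℝ) (n : ℕ) : Params N :=
  M.estimate θ₀ (history θ (M.policy F ρ η θ₀) e n)

lemma run_of_even {d : ℕ} (h : Even d) :
    run θ (M.policy F ρ η θ₀) e d = M.optimal F (M.est F θ ρ η θ₀ e d) := by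
  simp [run, policy, h, est]

/-- Index `n + 1` is the even day `n + 2`. Dropping its last record recovers the history after `n`
days, so both days of a pair share one estimate. -/
lemma run_succ_of_even {n : ℕ} (h : Even n) :
    run θ (M.policy F ρ η θ₀) e (n + 1) =
      { price := fun l => (M.optimal F (M.est F θ ρ η θ₀ e n)).price l
          - ρ / (M.est F θ ρ η θ₀ e n l).2 * ((n + 2 : ℕ) : ℝ) ^ (-η)
        supply := fun l => (M.optimal F (M.est F θ ρ η θ₀ e n)).supply l
          + ρ * ((n + 2 : ℕ) : ℝ) ^ (-η) } := by
  have h' : ¬ Even (n + 1) := by simpa [Nat.even_add_one] using h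
  have h2 := history_castLE θ (M.policy F ρ η θ₀) e (n.le_succ)
  rw [run, policy, if_neg h', est]
  simp only
  rw [← h2]
  rfl

/-- The assumptions on the demand model and on the clairvoyant problem. -/
structure IsRegular (M : Market N) (F : Link N → Measure ℝ) (θ : Params N) : Prop where
  prob : ∀ l, IsProbabilityMeasure (F l)
  bounded : ∀ l, ∀ᵐ s ∂(F l), s ∈ Set.Icc M.εlo M.εhi
  mean : ∀ l, ∫ s, s ∂(F l) = 0
  params_mem : M.InBox θ
  caps : M.CapsInactive F θ

/-- The properties that almost all realizations of the initial guess and the shocks have. -/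
structure IsRegularPath (M : Market N) (F : Link N → Measure ℝ) (θ : Params N) (ρ η : ℝ)
    (θ₀ : Params N) (e : ℕ → Link N → ℝ) (D : ℕ) : Prop where
  guess_mem : M.InBox θ₀
  shock : ∀ k l, |e k l| ≤ M.size
  caps : ∀ n, Even n → n < D → M.CapsInactive F (M.est F θ ρ η θ₀ e n)

lemma IsRegular.negPart_mem (h : M.IsRegular F θ) (l : Link N) :
    negPart (F l) ∈ Set.Icc M.εlo 0 :=
  have := h.prob
  (Market.negPart_mem h.bounded h.mean l).1

lemma inBox_estimate (hθ : M.InBox θ) (h₀ : M.InBox θ₀) {n : ℕ} (h : Fin n → Record N) :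
    M.InBox (M.estimate θ₀ h) := by
  intro l
  unfold estimate
  have h1 := (hθ l).1.1.trans (hθ l).1.2
  have h2 := (hθ l).2.1.trans (hθ l).2.2
  split_ifs with hn
  · exact h₀ l
  · exact ⟨⟨le_max_right _ _, max_le (min_le_right _ _) h1⟩,
      ⟨le_max_right _ _, max_le (min_le_right _ _) h2⟩⟩

lemma inBox_est (hθ : M.InBox θ) (h₀ : M.InBox θ₀) (n : ℕ) :
    M.InBox (M.est F θ ρ η θ₀ e n) :=
  inBox_estimate hθ h₀ _

lemma InBox.intercept_le_size (h : M.InBox θ) (l : Link N) : |(θ l).1| ≤ M.size := by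
  have := h.abs_intercept_le l
  have := abs_nonneg M.εlo
  have := abs_nonneg M.εhi
  have := abs_nonneg M.βmax
  have := M.pmax_pos
  have := M.c_pos
  unfold size
  linarith

lemma InBox.slope_le_size (h : M.InBox θ) (l : Link N) : (θ l).2 ≤ M.size := by
  have := (le_abs_self _).trans (h.abs_slope_le l)
  have := abs_nonneg M.εlo
  have := abs_nonneg M.εhi
  have := abs_nonneg M.αmax
  have := M.pmax_pos
  have := M.c_pos
  unfold size
  linarith

lemma c_le_size (M : Market N) : M.c ≤ M.size := by
  have := abs_nonneg M.εlo
  have := abs_nonneg M.εhi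
  have := abs_nonneg M.αmax
  have := abs_nonneg M.βmax
  have := M.pmax_pos
  unfold size
  linarith

lemma abs_le_size_of_mem {s : ℝ} (hs : s ∈ Set.Icc M.εlo M.εhi) : |s| ≤ M.size := by
  have h1 := neg_abs_le M.εlo
  have h2 := le_abs_self M.εhi
  have := abs_nonneg M.εlo
  have := abs_nonneg M.εhi
  have := abs_nonneg M.αmax
  have := abs_nonneg M.βmax
  have := M.pmax_pos
  have := M.c_pos
  rw [abs_le]
  unfold size
  constructor <;> linarith [hs.1, hs.2]

lemma rpow_neg_le_one {n : ℕ} (hn : 1 ≤ n) (hη : 0 ≤ η) : (n : ℝ) ^ (-η) ≤ 1 :=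
  Real.rpow_le_one_of_one_le_of_nonpos (by exact_mod_cast hn) (by linarith)

/-- A bound for the prices that the policy charges. -/
def policyBound (M : Market N) (ρ : ℝ) : ℝ := M.priceBound + ρ / M.βmin

lemma policyBound_pos (M : Market N) (hρ : 0 < ρ) : 0 < M.policyBound ρ :=
  add_pos M.priceBound_pos (div_pos hρ M.βmin_pos)

lemma InBox.div_slope_le (h : M.InBox θ) (hρ : 0 ≤ ρ) (l : Link N) :
    ρ / (θ l).2 ≤ ρ / M.βmin :=
  div_le_div_of_nonneg_left hρ M.βmin_pos (h l).2.1

lemma InBox.le_div_slope (h : M.InBox θ) (hρ : 0 ≤ ρ) (l : Link N) :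
    ρ / M.size ≤ ρ / (θ l).2 :=
  div_le_div_of_nonneg_left hρ (h.slope_pos l) (h.slope_le_size l)

section Path

variable (hr : M.IsRegular F θ) (hp : M.IsRegularPath F θ ρ η θ₀ e D)
include hr

lemma IsRegular.abs_optimal_price_le {θ' : Params N} (hθ' : M.InBox θ')
    (hc : M.CapsInactive F θ') (l : Link N) : |(M.optimal F θ').price l| ≤ M.priceBound := by
  obtain ⟨σ, hσ⟩ := hc
  exact hσ.abs_price_le hr.negPart_mem hθ' l

lemma IsRegular.abs_optimal_price_sub_le {θ' θ'' : Params N} (hθ' : M.InBox θ')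
    (hc : M.CapsInactive F θ') (hθ'' : M.InBox θ'') (hc'' : M.CapsInactive F θ'') (l : Link N) :
    |(M.optimal F θ').price l - (M.optimal F θ'').price l| ≤
      M.priceLipschitz * paramDist θ' θ'' := by
  obtain ⟨σ, hσ⟩ := hc
  obtain ⟨σ', hσ'⟩ := hc''
  exact hσ.abs_price_sub_le hr.negPart_mem hθ' hθ'' hσ' l

lemma IsRegular.optimal_supply_eq {θ' : Params N} (hθ' : M.InBox θ')
    (hc : M.CapsInactive F θ') (l : Link N) :
    (M.optimal F θ').supply l = (θ' l).1 - (θ' l).2 * (M.optimal F θ').price l :=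
  have := hr.prob
  (hc.feasible_optimal hr.bounded hr.mean hθ').local_balance l

/-- A Lipschitz constant for the optimal supplies as functions of the parameters. -/
def _root_.NRPS.Market.supplyLipschitz (M : Market N) : ℝ :=
  1 + M.priceBound + M.size * M.priceLipschitz

lemma IsRegular.abs_optimal_supply_sub_le {θ' : Params N} (hθ' : M.InBox θ')
    (hc : M.CapsInactive F θ') (l : Link N) :
    |(M.optimal F θ').supply l - (M.optimal F θ).supply l| ≤
      M.supplyLipschitz * paramDist θ' θ := by
  rw [hr.optimal_supply_eq hθ' hc, hr.optimal_supply_eq hr.params_mem hr.caps]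
  have h1 := hr.abs_optimal_price_sub_le hθ' hc hr.params_mem hr.caps l
  have h2 := hr.abs_optimal_price_le hr.params_mem hr.caps l
  have h3 := le_paramDist θ' θ l
  have h4 := abs_nonneg ((θ' l).1 - (θ l).1)
  have h5 := abs_nonneg ((θ' l).2 - (θ l).2)
  have h6 := (hθ'.slope_pos l)
  have h7 := hθ'.slope_le_size l
  have h8 := M.priceBound_pos
  have heq : (θ' l).1 - (θ' l).2 * (M.optimal F θ').price l
      - ((θ l).1 - (θ l).2 * (M.optimal F θ).price l) =
      ((θ' l).1 - (θ l).1) - ((θ' l).2 - (θ l).2) * (M.optimal F θ).price l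
        - (θ' l).2 * ((M.optimal F θ').price l - (M.optimal F θ).price l) := by ring
  rw [heq, supplyLipschitz, add_mul, add_mul, one_mul]
  refine (abs_sub _ _).trans (add_le_add ((abs_sub _ _).trans (add_le_add (by linarith) ?_)) ?_)
  · rw [abs_mul, mul_comm]
    exact mul_le_mul h2 (by linarith) h5 h8.le
  · rw [abs_mul, abs_of_pos h6, mul_assoc]
    exact mul_le_mul h7 h1 (abs_nonneg _) (by linarith)

include hp

lemma IsRegularPath.abs_price_le (hρ : 0 < ρ) (hη : 0 ≤ η) {d : ℕ} (hd : d < D) (l : Link N) :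
    |(run θ (M.policy F ρ η θ₀) e d).price l| ≤ M.policyBound ρ := by
  have hpos := div_pos hρ M.βmin_pos
  rcases Nat.even_or_odd d with h | ⟨k, rfl⟩
  · rw [run_of_even h, policyBound]
    have := hr.abs_optimal_price_le (inBox_est hr.params_mem hp.guess_mem d)
      (hp.caps d h hd) l
    linarith
  · have hk : Even (2 * k) := even_two_mul k
    have hbox := inBox_est (F := F) (ρ := ρ) (η := η) (e := e) hr.params_mem hp.guess_mem (2 * k)
    have h1 := hr.abs_optimal_price_le hbox (hp.caps _ hk (by omega)) l
    rw [run_succ_of_even hk, policyBound]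
    refine (abs_sub _ _).trans (add_le_add h1 ?_)
    have hb := hbox.slope_pos l
    have h0 : (0 : ℝ) ≤ ((2 * k + 2 : ℕ) : ℝ) ^ (-η) := by positivity
    rw [abs_of_nonneg (by positivity)]
    have h2 := hbox.div_slope_le hρ.le l
    have h3 := rpow_neg_le_one (n := 2 * k + 2) (by omega) hη
    calc _ ≤ ρ / M.βmin * 1 := mul_le_mul h2 h3 h0 hpos.le
      _ = _ := mul_one _

/-- Both days start from the same optimal price, so the gap is exactly the offset. It is smallest
for the latest pair and the largest slope. -/
lemma IsRegularPath.price_gap_ge (hρ : 0 < ρ) (hη : 0 ≤ η) {m j : ℕ} (hj : j < m) (l : Link N) :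
    ρ / M.size * ((2 * m : ℕ) : ℝ) ^ (-η) ≤
      (run θ (M.policy F ρ η θ₀) e (2 * j)).price l
        - (run θ (M.policy F ρ η θ₀) e (2 * j + 1)).price l := by
  have hk : Even (2 * j) := even_two_mul j
  have hbox := inBox_est (F := F) (ρ := ρ) (η := η) (e := e) hr.params_mem hp.guess_mem (2 * j)
  rw [run_succ_of_even hk, run_of_even hk]
  simp only [sub_sub_cancel]
  have hs := hbox.slope_pos l
  refine mul_le_mul (hbox.le_div_slope hρ.le l) ?_ (by positivity) (by positivity)
  exact Real.rpow_le_rpow_of_nonpos (by positivity) (by exact_mod_cast (by omega)) (by linarith)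

lemma IsRegularPath.gramDet_ge (hρ : 0 < ρ) (hη : 0 ≤ η) {n : ℕ} (hn : Even n) (l : Link N) :
    (n : ℝ) ^ 2 * (ρ / M.size * (n : ℝ) ^ (-η)) ^ 2 / 4 ≤
      gramDet (fun k => (run θ (M.policy F ρ η θ₀) e k).price l) n := by
  obtain ⟨m, rfl⟩ := hn.two_dvd
  have := M.one_le_size
  exact NRPS.gramDet_ge (by positivity) fun j hj => hp.price_gap_ge hr hρ hη hj l

lemma IsRegularPath.gramDet_pos (hρ : 0 < ρ) (hη : 0 ≤ η) {n : ℕ} (hn : 2 ≤ n)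
    (l : Link N) : 0 < gramDet (fun k => (run θ (M.policy F ρ η θ₀) e k).price l) n := by
  refine lt_of_lt_of_le ?_ (gramDet_mono _ hn)
  refine lt_of_lt_of_le ?_ (hp.gramDet_ge hr hρ hη even_two l)
  have := M.one_le_size
  positivity

/-- The estimation error in terms of the self-normalized sum of the shocks. -/
lemma IsRegularPath.paramDist_est_le (hρ : 0 < ρ) (hη : 0 ≤ η) {n : ℕ} (hn : Even n)
    (hn2 : 2 ≤ n) (hnD : n ≤ D) :
    paramDist (M.est F θ ρ η θ₀ e n) θ ≤
      (1 + 2 * (1 + M.policyBound ρ) * M.size / ρ) * (n : ℝ) ^ (η - 1 / 2) *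
      ∑ l, Real.sqrt (selfNorm (fun k => (run θ (M.policy F ρ η θ₀) e k).price l)
        (fun k => e k l) n) := by
  rw [paramDist, Finset.mul_sum]
  refine Finset.sum_le_sum fun l _ => ?_
  set p : ℕ → ℝ := fun k => (run θ (M.policy F ρ η θ₀) e k).price l with hpdef
  have hdet := hp.gramDet_pos hr hρ hη hn2 l
  have hlow := hp.gramDet_ge hr hρ hη hn l
  have hS := M.one_le_size
  have hn0 : (0 : ℝ) < n := by exact_mod_cast (by omega : 0 < n)
  have hb := M.policyBound_pos hρ
  have herr := fit_error_le (y := fun k => demand θ (run θ (M.policy F ρ η θ₀) e k).price (e k) l)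
    (α := (θ l).1) (β := (θ l).2) (e := fun k => e k l) (p := p) (n := n)
    (b := M.policyBound ρ) (fun k _ => rfl) hdet
    (fun k hk => hp.abs_price_le hr hρ hη (by omega) l) (by positivity) hlow
  have hest : |(M.est F θ ρ η θ₀ e n l).1 - (θ l).1| + |(M.est F θ ρ η θ₀ e n l).2 - (θ l).2| ≤
      |fitIntercept p (fun k => demand θ (run θ (M.policy F ρ η θ₀) e k).price (e k) l) n
        - (θ l).1| +
      |fitSlope p (fun k => demand θ (run θ (M.policy F ρ η θ₀) e k).price (e k) l) n
        - (θ l).2| := by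
    have hne : n ≠ 0 := by omega
    simp only [est, estimate, if_neg hne]
    rw [leastSquares_eq_fit θ _ e l hdet]
    exact add_le_add (abs_max_min_sub_le (hr.params_mem l).1)
      (abs_max_min_sub_le (hr.params_mem l).2)
  refine hest.trans (herr.trans ?_)
  rw [Real.sqrt_div' _ hn0.le, ← mul_div_assoc, div_eq_mul_inv, mul_right_comm]
  refine mul_le_mul_of_nonneg_right ?_ (Real.sqrt_nonneg _)
  have h1 : (√(n : ℝ))⁻¹ = (n : ℝ) ^ (-(1 / 2) : ℝ) := by
    rw [Real.sqrt_eq_rpow, Real.rpow_neg hn0.le]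
  have h2 : (n : ℝ) ^ (η - 1 / 2) = (n : ℝ) ^ η * (n : ℝ) ^ (-(1 / 2) : ℝ) := by
    rw [← Real.rpow_add hn0]; ring_nf
  rw [h1, h2, ← mul_assoc]
  refine mul_le_mul_of_nonneg_right ?_ (by positivity)
  -- Since `δ` is proportional to `n ^ (-η)`, the factor `2 * (1 + b) / δ` contributes `n ^ η`; the
  -- summand `1` is absorbed by the same power.
  have h3 : 1 ≤ (n : ℝ) ^ η := Real.one_le_rpow (by exact_mod_cast (by omega)) hη
  have h4 : 2 * (1 + M.policyBound ρ) / (ρ / M.size * (n : ℝ) ^ (-η)) =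
      2 * (1 + M.policyBound ρ) * M.size / ρ * (n : ℝ) ^ η := by
    rw [Real.rpow_neg hn0.le]
    field_simp
  rw [h4, add_mul, one_mul]
  linarith

end Path

/-! ### Lipschitz bound for the daily loss. -/

section Gap

variable {x x' : Decision N} {b t : ℝ}

/-- The payoff is Lipschitz in the decision, near a decision that satisfies the local balance. -/
lemma abs_payoff_sub_le (hb0 : 0 ≤ b) (ht : 0 ≤ t) (hθ : M.InBox θ) {s : Link N → ℝ} (hs : ∀ l, |s l| ≤ M.size)
    (hx : ∀ l, x.supply l = (θ l).1 - (θ l).2 * x.price l) (hb : ∀ l, |x.price l| ≤ b)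
    (hb' : ∀ l, |x'.price l| ≤ b) (hprice : ∀ l, |x.price l - x'.price l| ≤ t)
    (hsupply : ∀ l, |x.supply l - x'.supply l| ≤ t) :
    |M.payoff θ x s - M.payoff θ x' s| ≤
      M.timeBound * (3 * M.size + 2 * M.size * b + b) * t := by
  have hS := M.one_le_size
  have hterm : ∀ l, |min (demand θ x.price s l) (x.supply l) * x.price l - x.supply l * M.c
      - (min (demand θ x'.price s l) (x'.supply l) * x'.price l - x'.supply l * M.c)| ≤
      (3 * M.size + 2 * M.size * b + b) * t := by
    intro l
    have hα := hθ.intercept_le_size l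
    have hβ := hθ.slope_le_size l
    have hβ0 := hθ.slope_pos l
    have hβp : |(θ l).2 * x.price l| ≤ M.size * b := by
      rw [abs_mul, abs_of_pos hβ0]
      exact mul_le_mul hβ (hb l) (abs_nonneg _) (by linarith)
    have hw : |x.supply l| ≤ M.size + M.size * b := by
      rw [hx l]
      exact (abs_sub _ _).trans (add_le_add hα hβp)
    have hd : |demand θ x.price s l| ≤ M.size + M.size * b + M.size := by
      unfold demand
      exact (abs_add_le _ _).trans (add_le_add ((abs_sub _ _).trans (add_le_add hα hβp)) (hs l))
    have hmin : |min (demand θ x.price s l) (x.supply l)| ≤ 2 * M.size + M.size * b := by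
      rw [abs_le] at hw hd ⊢
      exact ⟨le_min (by linarith) (by linarith), (min_le_left _ _).trans (by linarith)⟩
    have hdd : |demand θ x.price s l - demand θ x'.price s l| ≤ M.size * t := by
      have : demand θ x.price s l - demand θ x'.price s l =
          -((θ l).2 * (x.price l - x'.price l)) := by unfold demand; ring
      rw [this, abs_neg, abs_mul, abs_of_pos hβ0]
      exact mul_le_mul hβ (hprice l) (abs_nonneg _) (by linarith)
    have hmm : |min (demand θ x.price s l) (x.supply l)
        - min (demand θ x'.price s l) (x'.supply l)| ≤ M.size * t := by
      refine (abs_min_sub_min_le_max _ _ _ _).trans (max_le hdd ((hsupply l).trans ?_))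
      nlinarith
    -- Product rule for the revenue: one factor changes at a time.
    have heq : min (demand θ x.price s l) (x.supply l) * x.price l - x.supply l * M.c
      - (min (demand θ x'.price s l) (x'.supply l) * x'.price l - x'.supply l * M.c) =
      min (demand θ x.price s l) (x.supply l) * (x.price l - x'.price l)
      + (min (demand θ x.price s l) (x.supply l) - min (demand θ x'.price s l) (x'.supply l))
        * x'.price l - (x.supply l - x'.supply l) * M.c := by ring
    rw [heq]
    refine (abs_sub _ _).trans ((add_le_add_left (abs_add_le _ _) _).trans ?_)
    rw [abs_mul, abs_mul, abs_mul, abs_of_pos M.c_pos]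
    have e1 := mul_le_mul hmin (hprice l) (abs_nonneg _) (by positivity)
    have e2 := mul_le_mul hmm (hb' l) (abs_nonneg _) (by positivity)
    have e3 := mul_le_mul (hsupply l) M.c_le_size M.c_pos.le ht
    have e4 : 0 ≤ b * t := by positivity
    nlinarith
  have hsplit : M.payoff θ x s - M.payoff θ x' s = ∑ l, M.ξ l *
      (min (demand θ x.price s l) (x.supply l) * x.price l - x.supply l * M.c
      - (min (demand θ x'.price s l) (x'.supply l) * x'.price l - x'.supply l * M.c)) := by
    simp only [payoff, ← Finset.sum_sub_distrib]
    exact Finset.sum_congr rfl fun l _ => by ring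
  rw [hsplit]
  have h0 : 0 ≤ (3 * M.size + 2 * M.size * b + b) * t := by positivity
  calc _ ≤ ∑ l, M.ξ l * ((3 * M.size + 2 * M.size * b + b) * t) := by
        refine (Finset.abs_sum_le_sum_abs _ _).trans (Finset.sum_le_sum fun l _ => ?_)
        rw [abs_mul, abs_of_pos (M.ξ_pos l)]
        exact mul_le_mul_of_nonneg_left (hterm l) (M.ξ_pos l).le
    _ = (M.timeBound - 1) * ((3 * M.size + 2 * M.size * b + b) * t) := by
        rw [← Finset.sum_mul, timeBound]
        ring
    _ ≤ _ := by linarith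

/-- The constant in the bound for the daily loss of the policy. -/
def gapConst (M : Market N) (ρ : ℝ) : ℝ :=
  M.timeBound * (3 * M.size + 2 * M.size * M.policyBound ρ + M.policyBound ρ)
    * (M.priceLipschitz + M.supplyLipschitz + ρ / M.βmin + ρ)

lemma supplyLipschitz_nonneg (M : Market N) : 0 ≤ M.supplyLipschitz := by
  have := M.priceBound_pos
  have := M.one_le_size
  have := M.priceLipschitz_nonneg
  unfold supplyLipschitz
  positivity

lemma gapConst_nonneg (M : Market N) (hρ : 0 < ρ) : 0 ≤ M.gapConst ρ := by
  have := M.policyBound_pos hρ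
  have := M.one_le_size
  have := M.priceLipschitz_nonneg
  have := M.supplyLipschitz_nonneg
  have := M.timeBound_pos
  have := M.βmin_pos
  unfold gapConst
  positivity

/-- Here `2 * (d / 2)` is the number of days behind the estimate used at index `d`, for either
parity of `d`. The estimate is two-sided and rests on Lipschitz continuity, not on a comparison of
optimal values. -/
lemma IsRegularPath.abs_gap_le (hr : M.IsRegular F θ) (hp : M.IsRegularPath F θ ρ η θ₀ e D)
    (hρ : 0 < ρ) (hη : 0 ≤ η) {d : ℕ} (hd : d < D) :
    |M.payoff θ (M.optimal F θ) (e d)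
        - M.payoff θ (M.policy F ρ η θ₀ d (history θ (M.policy F ρ η θ₀) e d)) (e d)| ≤
      M.gapConst ρ * (paramDist (M.est F θ ρ η θ₀ e (2 * (d / 2))) θ
        + ((d + 1 : ℕ) : ℝ) ^ (-η)) := by
  have hS := M.one_le_size
  have hb := M.policyBound_pos hρ
  have hβ := M.βmin_pos
  have hL := M.priceLipschitz_nonneg
  have hL' := M.supplyLipschitz_nonneg
  have hn : Even (2 * (d / 2)) := even_two_mul _
  have hbox := inBox_est (F := F) (ρ := ρ) (η := η) (e := e) hr.params_mem hp.guess_mem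
    (2 * (d / 2))
  have hcaps := hp.caps _ hn (by omega)
  have hD := paramDist_nonneg (M.est F θ ρ η θ₀ e (2 * (d / 2))) θ
  have hpow : (0 : ℝ) ≤ ((d + 1 : ℕ) : ℝ) ^ (-η) := by positivity
  have hpr := fun l => hr.abs_optimal_price_sub_le hbox hcaps hr.params_mem hr.caps l
  have hsu := fun l => hr.abs_optimal_supply_sub_le hbox hcaps l
  set T := paramDist (M.est F θ ρ η θ₀ e (2 * (d / 2))) θ with hT
  set κ : ℝ := ((d + 1 : ℕ) : ℝ) ^ (-η) with hκ
  have hK : ∀ l, |(M.optimal F θ).price l - (run θ (M.policy F ρ η θ₀) e d).price l| ≤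
        M.priceLipschitz * T + ρ / M.βmin * κ ∧
      |(M.optimal F θ).supply l - (run θ (M.policy F ρ η θ₀) e d).supply l| ≤
        M.supplyLipschitz * T + ρ * κ := by
    intro l
    rcases Nat.even_or_odd' d with ⟨k, rfl | rfl⟩
    · have hk : 2 * (2 * k / 2) = 2 * k := by omega
      rw [hk] at hpr hsu
      rw [run_of_even (even_two_mul k), abs_sub_comm, abs_sub_comm ((M.optimal F θ).supply l)]
      exact ⟨(hpr l).trans (le_add_of_nonneg_right (by positivity)),
        (hsu l).trans (le_add_of_nonneg_right (by positivity))⟩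
    · have hk : 2 * ((2 * k + 1) / 2) = 2 * k := by omega
      rw [hk] at hpr hsu hbox
      rw [run_succ_of_even (even_two_mul k), abs_sub_comm,
        abs_sub_comm ((M.optimal F θ).supply l)]
      simp only
      rw [sub_right_comm, add_sub_right_comm]
      have h1 := hbox.div_slope_le hρ.le l
      have h2 := hbox.slope_pos l
      refine ⟨(abs_sub _ _).trans (add_le_add (hpr l) ?_),
        (abs_add_le _ _).trans (add_le_add (hsu l) ?_)⟩
      · rw [abs_of_nonneg (by positivity)]
        exact mul_le_mul_of_nonneg_right h1 hpow
      · rw [abs_of_nonneg (by positivity)]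
  have ht : ∀ l, |(M.optimal F θ).price l - (run θ (M.policy F ρ η θ₀) e d).price l| ≤
        (M.priceLipschitz + M.supplyLipschitz + ρ / M.βmin + ρ) * (T + κ) ∧
      |(M.optimal F θ).supply l - (run θ (M.policy F ρ η θ₀) e d).supply l| ≤
        (M.priceLipschitz + M.supplyLipschitz + ρ / M.βmin + ρ) * (T + κ) := by
    intro l
    have h1 : 0 ≤ M.priceLipschitz * T := by positivity
    have h2 : 0 ≤ M.supplyLipschitz * T := by positivity
    have h3 : 0 ≤ M.priceLipschitz * κ := by positivity
    have h4 : 0 ≤ M.supplyLipschitz * κ := by positivity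
    have h5 : 0 ≤ ρ / M.βmin * T := by positivity
    have h6 : 0 ≤ ρ / M.βmin * κ := by positivity
    have h7 : 0 ≤ ρ * T := by positivity
    have h8 : 0 ≤ ρ * κ := by positivity
    exact ⟨(hK l).1.trans (by linarith), (hK l).2.trans (by linarith)⟩
  have hpb : M.priceBound ≤ M.policyBound ρ := le_add_of_nonneg_right (by positivity)
  refine (abs_payoff_sub_le hb.le (by positivity) hr.params_mem (hp.shock d)
    (hr.optimal_supply_eq hr.params_mem hr.caps)
    (fun l => (hr.abs_optimal_price_le hr.params_mem hr.caps l).trans hpb)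
    (fun l => hp.abs_price_le hr hρ hη hd l) (fun l => (ht l).1) (fun l => (ht l).2)).trans
    (le_of_eq ?_)
  rw [gapConst]
  ring

end Gap

end Market

end NRPS

end

/-! ### Independence of the past and measurability of the decisions. -/

noncomputable section

namespace NRPS

variable {N : ℕ} {Ω : Type*}

/-- If `X` is independent of `(A, B)` and `A` is independent of `B`, then `(X, A)` is independent
of `B`. -/
lemma indepFun_prodMk_of_indepFun [MeasurableSpace Ω] {P : Measure Ω} {𝒳 𝒜 ℬ : Type*} [MeasurableSpace 𝒳] [MeasurableSpace 𝒜]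
    [MeasurableSpace ℬ] [IsProbabilityMeasure P] {X : Ω → 𝒳} {A : Ω → 𝒜} {B : Ω → ℬ}
    (hX : Measurable X) (hA : Measurable A) (hB : Measurable B)
    (hXAB : IndepFun X (fun ω => (A ω, B ω)) P) (hAB : IndepFun A B P) :
    IndepFun (fun ω => (X ω, A ω)) B P := by
  have := Measure.isProbabilityMeasure_map (μ := P) hX.aemeasurable
  have := Measure.isProbabilityMeasure_map (μ := P) hA.aemeasurable
  have := Measure.isProbabilityMeasure_map (μ := P) hB.aemeasurable
  have hXA : IndepFun X A P := hXAB.comp measurable_id measurable_fst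
  rw [indepFun_iff_map_prod_eq_prod_map_map hX.aemeasurable (hA.prodMk hB).aemeasurable,
    (indepFun_iff_map_prod_eq_prod_map_map hA.aemeasurable hB.aemeasurable).1 hAB,
    ← Measure.prodAssoc_prod] at hXAB
  rw [indepFun_iff_map_prod_eq_prod_map_map (hX.prodMk hA).aemeasurable hB.aemeasurable,
    (indepFun_iff_map_prod_eq_prod_map_map hX.aemeasurable hA.aemeasurable).1 hXA]
  -- Joint laws may be compared after reassociation, where `hXAB` already gives the triple product.
  apply MeasurableEquiv.prodAssoc.map_measurableEquiv_injective
  rw [← hXAB, Measure.map_map MeasurableEquiv.prodAssoc.measurable ((hX.prodMk hA).prodMk hB)]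
  rfl

/-- What is known before day `d + 1`: the initial guess and the shocks of the first `d` days. -/
abbrev past (θ₀ : Ω → Params N) (ε : ℕ → Ω → Link N → ℝ) (d : ℕ) : MeasurableSpace Ω :=
  MeasurableSpace.comap (fun ω => (θ₀ ω, fun k : Finset.range d => ε k ω)) inferInstance

lemma measurable_pi_of_forall {m : MeasurableSpace Ω} {ι : Type*} {X : ι → Type*}
    [∀ i, MeasurableSpace (X i)] {f : Ω → ∀ i, X i} (h : ∀ i, Measurable fun ω => f ω i) :
    Measurable f :=
  measurable_pi_lambda _ h

section Past

variable {θ₀ : Ω → Params N} {ε : ℕ → Ω → Link N → ℝ}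

lemma measurable_guess_past (d : ℕ) : Measurable[past θ₀ ε d] θ₀ :=
  measurable_fst.comp (comap_measurable _)

lemma measurable_shock_past {k d : ℕ} (h : k < d) : Measurable[past θ₀ ε d] (ε k) :=
  (measurable_pi_apply (⟨k, Finset.mem_range.2 h⟩ : Finset.range d)).comp
    (measurable_snd.comp (comap_measurable
      (fun ω => (θ₀ ω, fun k : Finset.range d => ε k ω))))

lemma past_mono {k d : ℕ} (h : k ≤ d) : past θ₀ ε k ≤ past θ₀ ε d := by
  refine Measurable.comap_le ?_
  exact (measurable_guess_past d).prodMk (measurable_pi_of_forall fun j =>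
    measurable_shock_past ((Finset.mem_range.1 j.2).trans_le h))

end Past

section Regression

variable {m m₀ : MeasurableSpace Ω} {P : Measure[m₀] Ω}

lemma aestronglyMeasurable_sum_range {f : ℕ → Ω → ℝ} {n : ℕ}
    (hf : ∀ k ∈ Finset.range n, AEStronglyMeasurable[m] (f k) P) :
    AEStronglyMeasurable[m] (fun ω => ∑ k ∈ Finset.range n, f k ω) P := by
  induction n with
  | zero => simpa using aestronglyMeasurable_const
  | succ n ih =>
    simp only [Finset.sum_range_succ]
    exact (ih fun k hk => hf k (Finset.mem_range.2 ((Finset.mem_range.1 hk).trans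
      n.lt_succ_self))).add (hf n (Finset.self_mem_range_succ n))

lemma aestronglyMeasurable_gramDet {p : Ω → ℕ → ℝ} {n : ℕ}
    (hp : ∀ k < n, AEStronglyMeasurable[m] (fun ω => p ω k) P) :
    AEStronglyMeasurable[m] (fun ω => gramDet (p ω) n) P := by
  have hp' : ∀ k ∈ Finset.range n, AEStronglyMeasurable[m] (fun ω => p ω k) P :=
    fun k hk => hp k (Finset.mem_range.1 hk)
  exact ((aestronglyMeasurable_sum_range fun k hk => (hp' k hk).pow 2).const_mul _).sub
    ((aestronglyMeasurable_sum_range hp').pow 2)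

lemma aestronglyMeasurable_fitSlope {p y : Ω → ℕ → ℝ} {n : ℕ}
    (hp : ∀ k < n, AEStronglyMeasurable[m] (fun ω => p ω k) P)
    (hy : ∀ k < n, AEStronglyMeasurable[m] (fun ω => y ω k) P) :
    AEStronglyMeasurable[m] (fun ω => fitSlope (p ω) (y ω) n) P := by
  have hp' : ∀ k ∈ Finset.range n, AEStronglyMeasurable[m] (fun ω => p ω k) P :=
    fun k hk => hp k (Finset.mem_range.1 hk)
  have hy' : ∀ k ∈ Finset.range n, AEStronglyMeasurable[m] (fun ω => y ω k) P :=
    fun k hk => hy k (Finset.mem_range.1 hk)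
  exact (((aestronglyMeasurable_sum_range hp').mul
    (aestronglyMeasurable_sum_range hy')).sub
    ((aestronglyMeasurable_sum_range fun k hk => (hy' k hk).mul (hp' k hk)).const_mul _)).div₀
    (aestronglyMeasurable_gramDet hp)

lemma aestronglyMeasurable_fitIntercept {p y : Ω → ℕ → ℝ} {n : ℕ}
    (hp : ∀ k < n, AEStronglyMeasurable[m] (fun ω => p ω k) P)
    (hy : ∀ k < n, AEStronglyMeasurable[m] (fun ω => y ω k) P) :
    AEStronglyMeasurable[m] (fun ω => fitIntercept (p ω) (y ω) n) P := by
  have hp' : ∀ k ∈ Finset.range n, AEStronglyMeasurable[m] (fun ω => p ω k) P :=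
    fun k hk => hp k (Finset.mem_range.1 hk)
  have hy' : ∀ k ∈ Finset.range n, AEStronglyMeasurable[m] (fun ω => y ω k) P :=
    fun k hk => hy k (Finset.mem_range.1 hk)
  exact ((aestronglyMeasurable_sum_range hy').add
    ((aestronglyMeasurable_fitSlope hp hy).mul
      (aestronglyMeasurable_sum_range hp'))).div₀ aestronglyMeasurable_const

lemma aestronglyMeasurable_crossTerm {p e : Ω → ℕ → ℝ} {n : ℕ}
    (hp : ∀ k < n + 1, AEStronglyMeasurable[m] (fun ω => p ω k) P)
    (he : ∀ k < n, AEStronglyMeasurable[m] (fun ω => e ω k) P) :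
    AEStronglyMeasurable[m] (fun ω => crossTerm (p ω) (e ω) n) P := by
  have hp' : ∀ k ∈ Finset.range n, AEStronglyMeasurable[m] (fun ω => p ω k) P :=
    fun k hk => hp k (by have := Finset.mem_range.1 hk; omega)
  have he' : ∀ k ∈ Finset.range n, AEStronglyMeasurable[m] (fun ω => e ω k) P :=
    fun k hk => he k (Finset.mem_range.1 hk)
  have hpn := hp n n.lt_succ_self
  have hG := aestronglyMeasurable_sum_range fun k hk => (hp' k hk).pow 2
  have hB := aestronglyMeasurable_sum_range hp'
  have hX := aestronglyMeasurable_sum_range he'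
  have hY := aestronglyMeasurable_sum_range fun k hk => (he' k hk).mul (hp' k hk)
  exact ((((hG.mul hX).sub (hB.mul hY)).sub ((hB.mul hpn).mul hX)).add
    ((hpn.const_mul _).mul hY)).div₀ (aestronglyMeasurable_gramDet hp)

end Regression

namespace Market

variable [mΩ : MeasurableSpace Ω] {P : Measure Ω} {M : Market N} {F : Link N → Measure ℝ} {θ : Params N} {θ₀ : Ω → Params N}
  {ε : ℕ → Ω → Link N → ℝ} {ρ η : ℝ} {D : ℕ}

namespace IsEnvironment

lemma past_le (env : M.IsEnvironment P θ F ε θ₀) (d : ℕ) : past θ₀ ε d ≤ mΩ :=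
  Measurable.comap_le (env.guess_measurable.prodMk
    (measurable_pi_lambda _ fun k => env.shock_measurable k))

lemma measurable_shock (env : M.IsEnvironment P θ F ε θ₀) (d : ℕ) (l : Link N) :
    Measurable fun ω => ε d ω l :=
  (measurable_pi_apply l).comp (env.shock_measurable d)

lemma isRegular [IsProbabilityMeasure P] (env : M.IsEnvironment P θ F ε θ₀) (hc : M.CapsInactive F θ) :
    M.IsRegular F θ where
  prob l := by
    rw [← env.shock_law 0 l]
    exact Measure.isProbabilityMeasure_map (env.measurable_shock 0 l).aemeasurable
  bounded := env.shock_bounded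
  mean := env.shock_mean
  params_mem := env.params_mem
  caps := hc

lemma ae_shock_le (env : M.IsEnvironment P θ F ε θ₀) : ∀ᵐ ω ∂P, ∀ k l, |ε k ω l| ≤ M.size := by
  rw [ae_all_iff]
  intro k
  rw [ae_all_iff]
  intro l
  have h := env.shock_bounded l
  rw [← env.shock_law k l] at h
  exact (ae_of_ae_map (env.measurable_shock k l).aemeasurable h).mono
    fun ω hω => abs_le_size_of_mem hω

lemma integral_shock [IsProbabilityMeasure P] (env : M.IsEnvironment P θ F ε θ₀) (d : ℕ) (l : Link N) :
    ∫ ω, ε d ω l ∂P = 0 := by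
  rw [← env.shock_mean l, ← env.shock_law d l,
    integral_map (f := fun s : ℝ => s) (env.measurable_shock d l).aemeasurable
      measurable_id.aestronglyMeasurable]

/-- The guess is independent of the entire shock sequence and the days are mutually independent, so
guess and earlier shocks are jointly independent of the new day. -/
lemma indepFun_past [IsProbabilityMeasure P] (env : M.IsEnvironment P θ F ε θ₀) (d : ℕ) :
    IndepFun (fun ω => (θ₀ ω, fun k : Finset.range d => ε k ω)) (ε d) P := by
  have hA : Measurable fun ω => fun k : Finset.range d => ε k ω :=
    measurable_pi_lambda _ fun k => env.shock_measurable k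
  refine indepFun_prodMk_of_indepFun env.guess_measurable hA (env.shock_measurable d) ?_ ?_
  · exact env.guess_indep.comp (φ := id) (ψ := fun s : ℕ → Link N → ℝ =>
      ((fun k : Finset.range d => s k), s d)) measurable_id
      ((measurable_pi_lambda _ fun k => measurable_pi_apply _).prodMk (measurable_pi_apply _))
  · have h := env.shock_indep.indepFun_finset (Finset.range d) {d} (by simp)
      env.shock_measurable
    exact h.comp (φ := id)
      (ψ := fun s : ({d} : Finset ℕ) → Link N → ℝ => s ⟨d, Finset.mem_singleton_self d⟩)
      measurable_id (measurable_pi_apply _)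

/-- The martingale difference property, without conditional expectations: a past-measurable version
of `y` is independent of the new shock, which has mean zero. -/
lemma integral_shock_mul [IsProbabilityMeasure P] (env : M.IsEnvironment P θ F ε θ₀) {d : ℕ} (l : Link N) {y : Ω → ℝ}
    (hy : AEStronglyMeasurable[past θ₀ ε d] y P) : ∫ ω, ε d ω l * y ω ∂P = 0 := by
  obtain ⟨y', hy', hyy'⟩ := hy
  have hmeas : Measurable[past θ₀ ε d] y' := hy'.measurable
  have hind : IndepFun (fun ω => ε d ω l) y' P := by
    rw [IndepFun_iff_Indep]
    have h := env.indepFun_past d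
    rw [IndepFun_iff_Indep] at h
    refine indep_of_indep_of_le_left (indep_of_indep_of_le_right h.symm hmeas.comap_le) ?_
    exact ((measurable_pi_apply l).comp (comap_measurable (ε d))).comap_le
  have hm : Measurable y' := hmeas.mono (env.past_le d) le_rfl
  rw [integral_congr_ae (g := fun ω => ε d ω l * y' ω) (hyy'.mono fun ω h => by simp only [h]),
    hind.integral_fun_mul_eq_mul_integral (env.measurable_shock d l).aestronglyMeasurable
      hm.aestronglyMeasurable, env.integral_shock, zero_mul]

end IsEnvironment

section Measurability

/-- Optimal prices are Lipschitz on the set where the price caps are inactive. -/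
lemma IsRegular.exists_continuous_price (hr : M.IsRegular F θ) :
    ∃ f : Params N → Link N → ℝ, Continuous f ∧
      ∀ θ', M.InBox θ' → M.CapsInactive F θ' → (M.optimal F θ').price = f θ' := by
  have hlip : LipschitzOnWith (Real.toNNReal (M.priceLipschitz * (2 * Fintype.card (Link N))))
      (fun θ' => (M.optimal F θ').price) {θ' | M.InBox θ' ∧ M.CapsInactive F θ'} := by
    refine LipschitzOnWith.of_dist_le_mul fun x hx y hy => ?_
    have hL := M.priceLipschitz_nonneg
    rw [Real.coe_toNNReal _ (by positivity), dist_pi_le_iff (by positivity)]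
    intro l
    rw [Real.dist_eq]
    refine (hr.abs_optimal_price_sub_le hx.1 hx.2 hy.1 hy.2 l).trans ?_
    rw [mul_assoc]
    refine mul_le_mul_of_nonneg_left ?_ hL
    calc paramDist x y ≤ ∑ _l : Link N, 2 * dist x y := by
          refine Finset.sum_le_sum fun l _ => ?_
          have h1 := dist_le_pi_dist x y l
          have h2 : |(x l).1 - (y l).1| ≤ dist (x l) (y l) := by
            rw [Prod.dist_eq]
            exact le_max_left _ _
          have h3 : |(x l).2 - (y l).2| ≤ dist (x l) (y l) := by
            rw [Prod.dist_eq]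
            exact le_max_right _ _
          linarith
      _ = _ := by
          simp
          ring
  -- An `epsilon` choice carries no measurability. Its Lipschitz restriction to the good set extends
  -- to a continuous function that can replace it almost surely.
  obtain ⟨g, hg, hfg⟩ := hlip.extend_pi
  exact ⟨g, hg.continuous, fun θ' h h' => hfg ⟨h, h'⟩⟩

/-- The estimates are measurable functions of the past, if the prices are. -/
lemma aestronglyMeasurable_est (hr : M.IsRegular F θ)
    (hreg : ∀ᵐ ω ∂P, M.IsRegularPath F θ ρ η (θ₀ ω) (fun d => ε d ω) D) (hρ : 0 < ρ)
    (hη : 0 ≤ η) {n : ℕ} (hn : Even n)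
    (hp : ∀ k < n, ∀ l, AEStronglyMeasurable[past θ₀ ε n]
      (fun ω => (run θ (M.policy F ρ η (θ₀ ω)) (fun d => ε d ω) k).price l) P) :
    ∃ g : Ω → Params N, Measurable[past θ₀ ε n] g ∧
      ∀ᵐ ω ∂P, M.est F θ ρ η (θ₀ ω) (fun d => ε d ω) n = g ω := by
  rcases Nat.eq_zero_or_pos n with rfl | hn0
  · exact ⟨θ₀, measurable_guess_past 0, Filter.Eventually.of_forall fun ω => by
      funext l
      simp [est, estimate]⟩
  have hn2 : 2 ≤ n := by
    obtain ⟨k, rfl⟩ := hn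
    omega
  have hshock : ∀ k < n, ∀ l, AEStronglyMeasurable[past θ₀ ε n] (fun ω => ε k ω l) P :=
    fun k hk l => (((measurable_pi_apply l).comp
      (measurable_shock_past hk)).stronglyMeasurable).aestronglyMeasurable
  have hy : ∀ k < n, ∀ l, AEStronglyMeasurable[past θ₀ ε n] (fun ω =>
      demand θ (run θ (M.policy F ρ η (θ₀ ω)) (fun d => ε d ω) k).price (ε k ω) l) P :=
    fun k hk l => (aestronglyMeasurable_const.sub ((hp k hk l).const_mul _)).add (hshock k hk l)
  have hclip : ∀ lo hi : ℝ, Continuous fun x : ℝ => max (min x hi) lo := fun lo hi => by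
    fun_prop
  have ha := fun l => (hclip M.αmin M.αmax).comp_aestronglyMeasurable
    (aestronglyMeasurable_fitIntercept (fun k hk => hp k hk l) (fun k hk => hy k hk l))
  have hb := fun l => (hclip M.βmin M.βmax).comp_aestronglyMeasurable
    (aestronglyMeasurable_fitSlope (fun k hk => hp k hk l) (fun k hk => hy k hk l))
  choose a ha1 ha2 using ha
  choose b hb1 hb2 using hb
  refine ⟨fun ω l => (a l ω, b l ω), measurable_pi_of_forall fun l =>
    (ha1 l).measurable.prodMk (hb1 l).measurable, ?_⟩
  filter_upwards [hreg, ae_all_iff.2 ha2, ae_all_iff.2 hb2] with ω hω h1 h2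
  funext l
  -- Almost surely the Gram determinant is positive, so the chosen least squares solution equals the
  -- measurable closed form.
  have hls := leastSquares_eq_fit θ (M.policy F ρ η (θ₀ ω)) (fun d => ε d ω) l
    (hω.gramDet_pos hr hρ hη hn2 l)
  simp only [est, estimate, if_neg hn0.ne', hls]
  exact Prod.ext (h1 l) (h2 l)

lemma ae_est_mem (hr : M.IsRegular F θ)
    (hreg : ∀ᵐ ω ∂P, M.IsRegularPath F θ ρ η (θ₀ ω) (fun d => ε d ω) D) {n : ℕ} (hn : Even n)
    (hnD : n < D) : ∀ᵐ ω ∂P, M.InBox (M.est F θ ρ η (θ₀ ω) (fun d => ε d ω) n) ∧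
      M.CapsInactive F (M.est F θ ρ η (θ₀ ω) (fun d => ε d ω) n) :=
  hreg.mono fun _ hω => ⟨inBox_est hr.params_mem hω.guess_mem n, hω.caps n hn hnD⟩

/-- The prices of day `d + 1` are measurable functions of the past. -/
lemma aestronglyMeasurable_price (hr : M.IsRegular F θ)
    (hreg : ∀ᵐ ω ∂P, M.IsRegularPath F θ ρ η (θ₀ ω) (fun d => ε d ω) D) (hρ : 0 < ρ)
    (hη : 0 ≤ η) {d : ℕ} (hd : d < D) (l : Link N) :
    AEStronglyMeasurable[past θ₀ ε d]
      (fun ω => (run θ (M.policy F ρ η (θ₀ ω)) (fun d => ε d ω) d).price l) P := by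
  -- Earlier prices determine the estimate, which determines the next price. The induction runs over
  -- all links at once because each price depends on the estimates of every link.
  induction d using Nat.strong_induction_on generalizing l with
  | _ d ih =>
  obtain ⟨f, hf, hfp⟩ := hr.exists_continuous_price
  rcases Nat.even_or_odd' d with ⟨k, rfl | rfl⟩
  · have hk : Even (2 * k) := even_two_mul k
    obtain ⟨g, hg, hgest⟩ := aestronglyMeasurable_est hr hreg hρ hη hk
      (fun j hj l => (ih j hj (by omega) l).mono (past_mono hj.le))
    refine ⟨fun ω => f (g ω) l, ((measurable_pi_apply l).comp
      (hf.measurable.comp hg)).stronglyMeasurable, ?_⟩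
    filter_upwards [hgest, ae_est_mem hr hreg hk hd] with ω h1 h2
    rw [run_of_even hk, hfp _ h2.1 h2.2, h1]
  · have hk : Even (2 * k) := even_two_mul k
    obtain ⟨g, hg, hgest⟩ := aestronglyMeasurable_est hr hreg hρ hη hk
      (fun j hj l => (ih j (by omega) (by omega) l).mono (past_mono hj.le))
    have hg' := hg.mono (past_mono (θ₀ := θ₀) (ε := ε) (2 * k).le_succ) le_rfl
    refine ⟨fun ω => f (g ω) l - ρ / (g ω l).2 * ((2 * k + 2 : ℕ) : ℝ) ^ (-η), ?_, ?_⟩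
    · exact (((measurable_pi_apply l).comp (hf.measurable.comp hg')).sub
        ((measurable_const.div (measurable_snd.comp ((measurable_pi_apply l).comp hg'))).mul_const
          _)).stronglyMeasurable
    · filter_upwards [hgest, ae_est_mem hr hreg hk (by omega)] with ω h1 h2
      rw [run_succ_of_even hk, hfp _ h2.1 h2.2, h1]

/-- The supplies are measurable functions of the realization. -/
lemma aestronglyMeasurable_supply (env : M.IsEnvironment P θ F ε θ₀) (hr : M.IsRegular F θ)
    (hreg : ∀ᵐ ω ∂P, M.IsRegularPath F θ ρ η (θ₀ ω) (fun d => ε d ω) D) (hρ : 0 < ρ)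
    (hη : 0 ≤ η) {d : ℕ} (hd : d < D) (l : Link N) :
    AEStronglyMeasurable
      (fun ω => (run θ (M.policy F ρ η (θ₀ ω)) (fun d => ε d ω) d).supply l) P := by
  obtain ⟨f, hf, hfp⟩ := hr.exists_continuous_price
  have hk : Even (2 * (d / 2)) := even_two_mul _
  obtain ⟨g, hg, hgest⟩ := aestronglyMeasurable_est hr hreg hρ hη hk
    (fun j hj l => (aestronglyMeasurable_price hr hreg hρ hη (by omega) l).mono
      (past_mono hj.le))
  have hg' : Measurable g := hg.mono (env.past_le _) le_rfl
  have hgl := (measurable_pi_apply l).comp hg'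
  have hw : Measurable fun ω => (g ω l).1 - (g ω l).2 * f (g ω) l :=
    (measurable_fst.comp hgl).sub ((measurable_snd.comp hgl).mul
      ((measurable_pi_apply l).comp (hf.measurable.comp hg')))
  have hmem := ae_est_mem hr hreg hk (by omega)
  rcases Nat.even_or_odd' d with ⟨k, rfl | rfl⟩
  · have hkk : 2 * (2 * k / 2) = 2 * k := by omega
    rw [hkk] at hk hgest hmem
    refine ⟨_, hw.stronglyMeasurable, ?_⟩
    filter_upwards [hgest, hmem] with ω h1 h2
    rw [run_of_even hk, hr.optimal_supply_eq h2.1 h2.2, hfp _ h2.1 h2.2, h1]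
  · have hkk : 2 * ((2 * k + 1) / 2) = 2 * k := by omega
    rw [hkk] at hk hgest hmem
    refine ⟨_, (hw.add_const (ρ * ((2 * k + 2 : ℕ) : ℝ) ^ (-η))).stronglyMeasurable, ?_⟩
    filter_upwards [hgest, hmem] with ω h1 h2
    rw [run_succ_of_even hk]
    simp only
    rw [hr.optimal_supply_eq h2.1 h2.2, hfp _ h2.1 h2.2, h1]

end Measurability

end Market

end NRPS

end

/-! ### Expectations, the mean estimation error, and the regret. -/

noncomputable section

namespace NRPS

variable {N : ℕ}

/-- A crude bound; it serves only to make the cross terms integrable. -/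
lemma abs_crossTerm_le {p e : ℕ → ℝ} {n : ℕ} {b E c : ℝ} (hb0 : 0 ≤ b) (hE0 : 0 ≤ E)
    (hp : ∀ k < n + 1, |p k| ≤ b) (he : ∀ k < n, |e k| ≤ E) (hc : 0 < c)
    (hdet : c ≤ gramDet p (n + 1)) : |crossTerm p e n| ≤ 4 * (n ^ 2 * b ^ 2 * E) / c := by
  have hsum : ∀ (f : ℕ → ℝ) (B : ℝ), (∀ k < n, |f k| ≤ B) →
      |∑ k ∈ Finset.range n, f k| ≤ n * B := fun f B hf => by
    refine (Finset.abs_sum_le_sum_abs _ _).trans ?_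
    calc _ ≤ ∑ _k ∈ Finset.range n, B :=
          Finset.sum_le_sum fun k hk => hf k (Finset.mem_range.1 hk)
      _ = _ := by simp
  have hG := hsum (fun k => p k ^ 2) (b ^ 2) fun k hk => by
    rw [abs_pow]
    exact pow_le_pow_left₀ (abs_nonneg _) (hp k (by omega)) 2
  have hB := hsum p b fun k hk => hp k (by omega)
  have hX := hsum e E he
  have hY := hsum (fun k => e k * p k) (E * b) fun k hk => by
    rw [abs_mul]
    exact mul_le_mul (he k hk) (hp k (by omega)) (abs_nonneg _) hE0
  have hpn := hp n n.lt_succ_self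
  rw [crossTerm, abs_div, abs_of_pos (hc.trans_le hdet)]
  refine div_le_div₀ (by positivity) ?_ hc hdet
  refine (abs_add_le _ _).trans ((add_le_add_left ((abs_sub _ _).trans
    (add_le_add_left (abs_sub _ _) _)) _).trans ?_)
  have e1 := mul_le_mul hG hX (abs_nonneg _) (by positivity)
  have e2 := mul_le_mul hB hY (abs_nonneg _) (by positivity)
  have e3 := mul_le_mul (mul_le_mul hB hpn (abs_nonneg _) (by positivity)) hX (abs_nonneg _)
    (by positivity)
  have e4 := mul_le_mul (mul_le_mul_of_nonneg_left hpn (Nat.cast_nonneg (α := ℝ) n)) hY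
    (abs_nonneg _) (by positivity)
  simp only [abs_mul, Nat.abs_cast] at e1 e2 e3 e4 ⊢
  linarith

/-- Comparison with a telescoping sum: Bernoulli's inequality for `(1 - 1 / x) ^ (1 - a)` bounds
each term by an increment of `x ^ (1 - a) / (1 - a)`. -/
lemma sum_rpow_neg_le {a : ℝ} (ha : 0 < a) (ha1 : a < 1) (D : ℕ) :
    ∑ d ∈ Finset.range D, ((d + 1 : ℕ) : ℝ) ^ (-a) ≤ (D : ℝ) ^ (1 - a) / (1 - a) := by
  have h1 : 0 < 1 - a := by linarith
  induction D with
  | zero => simp [Real.zero_rpow h1.ne']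
  | succ D ih =>
    rw [Finset.sum_range_succ]
    have hD : (0 : ℝ) < ((D + 1 : ℕ) : ℝ) := by positivity
    set x : ℝ := ((D + 1 : ℕ) : ℝ) with hx
    have hDx : (D : ℝ) = x * (1 + -(1 / x)) := by
      rw [hx]; field_simp; push_cast; ring
    have hx1 : 1 / x ≤ 1 := by
      rw [div_le_one hD, hx]; exact_mod_cast Nat.le_add_left 1 D
    have hbern := rpow_one_add_le_one_add_mul_self (s := -(1 / x)) (by linarith) h1.le
      (by linarith : 1 - a ≤ 1)
    have hpow : (D : ℝ) ^ (1 - a) ≤ x ^ (1 - a) - (1 - a) * x ^ (-a) := by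
      rw [hDx, Real.mul_rpow hD.le (by linarith)]
      refine (mul_le_mul_of_nonneg_left hbern (by positivity)).trans (le_of_eq ?_)
      have : x ^ (1 - a) = x * x ^ (-a) := by
        rw [sub_eq_add_neg, Real.rpow_add hD, Real.rpow_one]
      rw [this]
      field_simp
      ring
    rw [le_div_iff₀ h1] at ih ⊢
    linarith

lemma selfNorm_nonneg {p e : ℕ → ℝ} {n : ℕ} (h : 0 < gramDet p n) : 0 ≤ selfNorm p e n := by
  rw [selfNorm_eq (y := fun k => 0 - 0 * p k + e k) (fun k _ => rfl) h]
  positivity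

/-- The arithmetic-geometric mean inequality. The bound is affine in `u`, so expectations pass
through it with a deterministic `v`, which takes the place of Jensen's inequality. -/
lemma sqrt_le_of_le {q u v : ℝ} (hq : 0 ≤ q) (hqu : q ≤ u) (hv : 0 < v) :
    √q ≤ (u / v + v) / 2 := by
  have h0 : (u / v + v) / 2 = (u + v ^ 2) / (2 * v) := by field_simp
  rw [h0, le_div_iff₀ (by positivity)]
  nlinarith [sq_nonneg (√q - v), Real.sq_sqrt hq]

namespace Market

variable {Ω : Type*} [mΩ : MeasurableSpace Ω] {P : Measure Ω} [IsProbabilityMeasure P]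
  {M : Market N} {F : Link N → Measure ℝ} {θ : Params N} {θ₀ : Ω → Params N}
  {ε : ℕ → Ω → Link N → ℝ} {ρ η : ℝ} {D : ℕ}

/-- A lower bound for the Gram determinants of the prices after the first two days. -/
def detBound (M : Market N) (ρ η : ℝ) : ℝ := (ρ / M.size * (2 : ℝ) ^ (-η)) ^ 2

lemma detBound_pos (M : Market N) (hρ : 0 < ρ) : 0 < M.detBound ρ η := by
  have := M.one_le_size
  unfold detBound
  positivity

lemma IsRegularPath.detBound_le {ϑ : Params N} {e : ℕ → Link N → ℝ} (hr : M.IsRegular F θ)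
    (hp : M.IsRegularPath F θ ρ η ϑ e D) (hρ : 0 < ρ) (hη : 0 ≤ η) {n : ℕ} (hn : 2 ≤ n)
    (l : Link N) :
    M.detBound ρ η ≤ gramDet (fun k => (run θ (M.policy F ρ η ϑ) e k).price l) n := by
  refine le_trans ?_ (gramDet_mono _ hn)
  refine le_trans (le_of_eq ?_) (hp.gramDet_ge hr hρ hη even_two l)
  rw [detBound]
  push_cast
  ring

/-- An integrable upper bound for the self-normalized sum of the shocks of the first `n` days. -/
def normBound (M : Market N) (F : Link N → Measure ℝ) (θ : Params N) (ρ η : ℝ) (ϑ : Params N)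
    (e : ℕ → Link N → ℝ) (n : ℕ) (l : Link N) : ℝ :=
  2 * M.size ^ 2 + 2 * ∑ k ∈ Finset.Ico 2 n, e k l *
      crossTerm (fun k => (run θ (M.policy F ρ η ϑ) e k).price l) (fun k => e k l) k
    + M.size ^ 2 * (Real.log (n ^ 2 * M.policyBound ρ ^ 2) - Real.log (M.detBound ρ η))

/-- The random Gram determinants are replaced by deterministic bounds, so that only the cross terms
remain to be averaged. -/
lemma IsRegularPath.selfNorm_le {ϑ : Params N} {e : ℕ → Link N → ℝ} (hr : M.IsRegular F θ)
    (hp : M.IsRegularPath F θ ρ η ϑ e D) (hρ : 0 < ρ) (hη : 0 ≤ η) {n : ℕ} (hn : 2 ≤ n)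
    (hnD : n ≤ D) (l : Link N) :
    selfNorm (fun k => (run θ (M.policy F ρ η ϑ) e k).price l) (fun k => e k l) n ≤
      M.normBound F θ ρ η ϑ e n l := by
  refine (NRPS.selfNorm_le (hp.gramDet_pos hr hρ hη le_rfl l) hn
    fun k => hp.shock k l).trans ?_
  have h1 := Real.log_le_log (hp.gramDet_pos hr hρ hη hn l)
    (gramDet_le fun k hk => hp.abs_price_le hr hρ hη (lt_of_lt_of_le hk hnD) l)
  have h2 := Real.log_le_log (M.detBound_pos (η := η) hρ) (hp.detBound_le hr hρ hη le_rfl l)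
  rw [normBound]
  have := sq_nonneg M.size
  gcongr

section Expectation

variable (env : M.IsEnvironment P θ F ε θ₀) (hr : M.IsRegular F θ)
  (hreg : ∀ᵐ ω ∂P, M.IsRegularPath F θ ρ η (θ₀ ω) (fun d => ε d ω) D) (hρ : 0 < ρ) (hη : 0 ≤ η)
include env hr hreg hρ hη

/-- The cross term involves the price of the current day but only earlier shocks, so it is
measurable with respect to the past. -/
lemma integral_shock_mul_crossTerm {n : ℕ} (hn : 2 ≤ n) (hnD : n < D) (l : Link N) :
    Integrable (fun ω => ε n ω l * crossTerm
      (fun k => (run θ (M.policy F ρ η (θ₀ ω)) (fun d => ε d ω) k).price l)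
      (fun k => ε k ω l) n) P ∧
    ∫ ω, ε n ω l * crossTerm
      (fun k => (run θ (M.policy F ρ η (θ₀ ω)) (fun d => ε d ω) k).price l)
      (fun k => ε k ω l) n ∂P = 0 := by
  have hmeas : AEStronglyMeasurable[past θ₀ ε n] (fun ω => crossTerm
      (fun k => (run θ (M.policy F ρ η (θ₀ ω)) (fun d => ε d ω) k).price l)
      (fun k => ε k ω l) n) P :=
    aestronglyMeasurable_crossTerm
      (p := fun ω k => (run θ (M.policy F ρ η (θ₀ ω)) (fun d => ε d ω) k).price l)
      (e := fun ω k => ε k ω l)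
      (fun k hk => (aestronglyMeasurable_price hr hreg hρ hη (by omega) l).mono
        (past_mono (by omega)))
      (fun k hk => (((measurable_pi_apply l).comp
        (measurable_shock_past hk)).stronglyMeasurable).aestronglyMeasurable)
  refine ⟨?_, env.integral_shock_mul l hmeas⟩
  have hS := M.one_le_size
  have hb := M.policyBound_pos hρ
  have hc := M.detBound_pos (η := η) hρ
  refine Integrable.of_bound ((env.measurable_shock n l).aestronglyMeasurable.mul
    (hmeas.mono (env.past_le n)))
    (M.size * (4 * (n ^ 2 * M.policyBound ρ ^ 2 * M.size) / M.detBound ρ η)) ?_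
  filter_upwards [hreg] with ω hω
  rw [Real.norm_eq_abs, abs_mul]
  refine mul_le_mul (hω.shock n l) ?_ (abs_nonneg _) (by linarith)
  exact abs_crossTerm_le hb.le (by linarith)
    (fun k hk => hω.abs_price_le hr hρ hη (by omega) l) (fun k _ => hω.shock k l) hc
    (hω.detBound_le hr hρ hη (by omega) l)

lemma integral_normBound {n : ℕ} (hnD : n ≤ D) (l : Link N) :
    Integrable (fun ω => M.normBound F θ ρ η (θ₀ ω) (fun d => ε d ω) n l) P ∧
    ∫ ω, M.normBound F θ ρ η (θ₀ ω) (fun d => ε d ω) n l ∂P =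
      2 * M.size ^ 2 + M.size ^ 2 *
        (Real.log (n ^ 2 * M.policyBound ρ ^ 2) - Real.log (M.detBound ρ η)) := by
  have h := fun k (hk : k ∈ Finset.Ico 2 n) =>
    integral_shock_mul_crossTerm env hr hreg hρ hη (Finset.mem_Ico.1 hk).1
      ((Finset.mem_Ico.1 hk).2.trans_le hnD) l
  have hsum := (integrable_finsetSum (Finset.Ico 2 n) fun k hk => (h k hk).1).const_mul 2
  have h1 := (integrable_const (μ := P) (2 * M.size ^ 2)).add hsum
  refine ⟨h1.add (integrable_const _), ?_⟩
  have e1 := integral_add h1 (integrable_const (M.size ^ 2 *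
    (Real.log (n ^ 2 * M.policyBound ρ ^ 2) - Real.log (M.detBound ρ η))))
  have e2 := integral_add (integrable_const (μ := P) (2 * M.size ^ 2)) hsum
  simp only [Pi.add_apply] at e1
  have e3 : ∫ ω, 2 * ∑ k ∈ Finset.Ico 2 n, ε k ω l * crossTerm
      (fun k => (run θ (M.policy F ρ η (θ₀ ω)) (fun d => ε d ω) k).price l)
      (fun k => ε k ω l) k ∂P = 0 := by
    rw [integral_const_mul, integral_finsetSum _ fun k hk => (h k hk).1,
      Finset.sum_eq_zero fun k hk => (h k hk).2, mul_zero]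
  unfold normBound
  rw [e1, e2, e3]
  simp

end Expectation

/-- The constant in the bound for the expected self-normalized sum. -/
def normConst (M : Market N) (ρ η : ℝ) : ℝ :=
  M.size ^ 2 * (4 + |2 * Real.log (M.policyBound ρ) - Real.log (M.detBound ρ η)|)

lemma normConst_pos (M : Market N) (ρ η : ℝ) : 0 < M.normConst ρ η := by
  have := M.one_le_size
  unfold normConst
  positivity

/-- The `4` in `normConst` collects `2` from the first two days and `2` from `log (n ^ 2)`; the
constants are absorbed because `1 ≤ log D`. -/
lemma normBound_mean_le (hρ : 0 < ρ) {n : ℕ} (hn : 2 ≤ n) (hnD : n ≤ D)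
    (hD : 1 ≤ Real.log D) :
    2 * M.size ^ 2 + M.size ^ 2 *
        (Real.log (n ^ 2 * M.policyBound ρ ^ 2) - Real.log (M.detBound ρ η)) ≤
      M.normConst ρ η * Real.log D := by
  have hn0 : (0 : ℝ) < n := by exact_mod_cast (by omega : 0 < n)
  have hb := M.policyBound_pos hρ
  rw [Real.log_mul (by positivity) (by positivity), Real.log_pow, Real.log_pow, normConst]
  have h1 : Real.log n ≤ Real.log D := Real.log_le_log hn0 (by exact_mod_cast hnD)
  have h2 := le_abs_self (2 * Real.log (M.policyBound ρ) - Real.log (M.detBound ρ η))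
  have h3 := mul_le_mul_of_nonneg_left hD
    (abs_nonneg (2 * Real.log (M.policyBound ρ) - Real.log (M.detBound ρ η)))
  have h4 := sq_nonneg M.size
  rw [mul_assoc, mul_comm 2 (M.size ^ 2), ← mul_add]
  refine mul_le_mul_of_nonneg_left ?_ h4
  push_cast
  linarith

lemma InBox.paramDist_le {θ' : Params N} (h : M.InBox θ) (h' : M.InBox θ') :
    paramDist θ θ' ≤ 4 * M.size * Fintype.card (Link N) := by
  calc paramDist θ θ' ≤ ∑ _l : Link N, 4 * M.size := by
        refine Finset.sum_le_sum fun l _ => ?_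
        have h1 := (abs_sub _ _).trans (add_le_add (h.intercept_le_size l)
          (h'.intercept_le_size l))
        have h2 := (abs_sub (θ l).2 (θ' l).2).trans (add_le_add
          ((abs_of_pos (h.slope_pos l)).le.trans (h.slope_le_size l))
          ((abs_of_pos (h'.slope_pos l)).le.trans (h'.slope_le_size l)))
        linarith
    _ = _ := by
        simp
        ring

/-- The constant that relates the estimation error to the self-normalized sum. -/
def errorConst (M : Market N) (ρ : ℝ) : ℝ := 1 + 2 * (1 + M.policyBound ρ) * M.size / ρ

lemma errorConst_pos (M : Market N) (hρ : 0 < ρ) : 0 < M.errorConst ρ := by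
  have := M.one_le_size
  have := M.policyBound_pos hρ
  unfold errorConst
  positivity

/-- Rounding down to an even number costs at most a factor `3` in the base, and the exponent lies
between `-1 / 2` and `0`. -/
lemma rpow_two_mul_half_le (hη : 0 ≤ η) (hη2 : η < 1 / 2) {d : ℕ} (hd : 2 ≤ d) :
    ((2 * (d / 2) : ℕ) : ℝ) ^ (η - 1 / 2) ≤ 3 * ((d + 1 : ℕ) : ℝ) ^ (η - 1 / 2) := by
  have h1 : ((d + 1 : ℕ) : ℝ) / 3 ≤ ((2 * (d / 2) : ℕ) : ℝ) := by
    rw [div_le_iff₀ (by norm_num)]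
    exact_mod_cast (by omega : d + 1 ≤ 2 * (d / 2) * 3)
  refine (Real.rpow_le_rpow_of_nonpos (by positivity) h1 (by linarith)).trans ?_
  rw [Real.div_rpow (by positivity) (by norm_num), div_eq_mul_inv, mul_comm,
    ← Real.rpow_neg (by norm_num)]
  refine mul_le_mul_of_nonneg_right ?_ (by positivity)
  calc (3 : ℝ) ^ (-(η - 1 / 2)) ≤ 3 ^ (1 : ℝ) :=
        Real.rpow_le_rpow_of_exponent_le (by norm_num) (by linarith)
    _ = 3 := Real.rpow_one 3

section Regret

variable (env : M.IsEnvironment P θ F ε θ₀) (hr : M.IsRegular F θ)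
  (hreg : ∀ᵐ ω ∂P, M.IsRegularPath F θ ρ η (θ₀ ω) (fun d => ε d ω) D) (hρ : 0 < ρ) (hη : 0 ≤ η)
include env hr hreg hρ hη

/-- An integrable upper bound for the estimation error, and a bound for its expectation. -/
lemma exists_error_bound (hη2 : η < 1 / 2) (hD : 1 ≤ Real.log D) {d : ℕ} (hd : d < D) :
    ∃ R : Ω → ℝ, Integrable R P ∧
      (∀ᵐ ω ∂P, paramDist (M.est F θ ρ η (θ₀ ω) (fun d => ε d ω) (2 * (d / 2))) θ ≤ R ω) ∧
      ∫ ω, R ω ∂P ≤ (if d < 2 then 4 * M.size * Fintype.card (Link N) else 0)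
        + 3 * M.errorConst ρ * Fintype.card (Link N) * √(M.normConst ρ η * Real.log D)
          * ((d + 1 : ℕ) : ℝ) ^ (η - 1 / 2) := by
  have hA := M.normConst_pos ρ η
  have hK := M.errorConst_pos hρ
  have hv : 0 < √(M.normConst ρ η * Real.log D) := Real.sqrt_pos.2 (by positivity)
  -- For `d < 2` the estimate is the initial guess, and only the size of the parameter box bounds
  -- its error.
  rcases lt_or_ge d 2 with h2 | h2
  · refine ⟨fun _ => 4 * M.size * Fintype.card (Link N), integrable_const _, ?_, ?_⟩
    · filter_upwards [hreg] with ω hω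
      exact (inBox_est hr.params_mem hω.guess_mem _).paramDist_le hr.params_mem
    · rw [if_pos h2]
      simp only [integral_const, probReal_univ, one_smul]
      exact le_add_of_nonneg_right (by positivity)
  set n := 2 * (d / 2) with hn
  have hne : Even n := even_two_mul _
  have hn2 : 2 ≤ n := by omega
  have hnD : n ≤ D := by omega
  set v := √(M.normConst ρ η * Real.log D) with hvdef
  have hU := fun l => integral_normBound env hr hreg hρ hη hnD l
  have hint : ∀ l : Link N, Integrable (fun ω =>
      (M.normBound F θ ρ η (θ₀ ω) (fun d => ε d ω) n l / v + v) / 2) P :=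
    fun l => (((hU l).1.div_const v).add (integrable_const v)).div_const 2
  -- The mean of `normBound` is at most `v ^ 2`, so this `v` balances the two halves of
  -- `sqrt_le_of_le`.
  have hval : ∀ l : Link N, ∫ ω,
      (M.normBound F θ ρ η (θ₀ ω) (fun d => ε d ω) n l / v + v) / 2 ∂P ≤ v := by
    intro l
    rw [integral_div, integral_add ((hU l).1.div_const v) (integrable_const v), integral_div,
      (hU l).2]
    simp only [integral_const, probReal_univ, one_smul]
    have h3 := M.normBound_mean_le (η := η) hρ hn2 hnD hD
    have h4 : v ^ 2 = M.normConst ρ η * Real.log D := Real.sq_sqrt (by positivity)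
    rw [← h4] at h3
    have h5 := (div_le_iff₀ hv).2 (h3.trans (le_of_eq (sq v)))
    linarith
  refine ⟨fun ω => M.errorConst ρ * (n : ℝ) ^ (η - 1 / 2) * ∑ l : Link N,
    (M.normBound F θ ρ η (θ₀ ω) (fun d => ε d ω) n l / v + v) / 2, ?_, ?_, ?_⟩
  · exact (integrable_finsetSum _ fun l _ => hint l).const_mul _
  · filter_upwards [hreg] with ω hω
    refine (hω.paramDist_est_le hr hρ hη hne hn2 hnD).trans ?_
    refine mul_le_mul_of_nonneg_left (Finset.sum_le_sum fun l _ => ?_) (by positivity)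
    exact sqrt_le_of_le (selfNorm_nonneg (hω.gramDet_pos hr hρ hη hn2 l))
      (hω.selfNorm_le hr hρ hη hn2 hnD l) hv
  · rw [integral_const_mul, integral_finsetSum _ fun l _ => hint l, if_neg (by omega), zero_add]
    have h3 : ∑ l : Link N, ∫ ω,
        (M.normBound F θ ρ η (θ₀ ω) (fun d => ε d ω) n l / v + v) / 2 ∂P ≤
        Fintype.card (Link N) * v := by
      calc _ ≤ ∑ _l : Link N, v := Finset.sum_le_sum fun l _ => hval l
        _ = _ := by simp
    have h4 := rpow_two_mul_half_le hη hη2 h2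
    calc _ ≤ M.errorConst ρ * (n : ℝ) ^ (η - 1 / 2) * (Fintype.card (Link N) * v) :=
          mul_le_mul_of_nonneg_left h3 (by positivity)
      _ ≤ M.errorConst ρ * (3 * ((d + 1 : ℕ) : ℝ) ^ (η - 1 / 2))
          * (Fintype.card (Link N) * v) := by gcongr
      _ = _ := by ring

lemma integrable_gap {d : ℕ} (hd : d < D) :
    Integrable (fun ω => M.payoff θ (M.optimal F θ) (ε d ω)
      - M.payoff θ (M.policy F ρ η (θ₀ ω) d
          (history θ (M.policy F ρ η (θ₀ ω)) (fun d => ε d ω) d)) (ε d ω)) P := by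
  have hε := fun l => (env.measurable_shock d l).aestronglyMeasurable (μ := P)
  have hprice := fun l => (aestronglyMeasurable_price hr hreg hρ hη hd l).mono (env.past_le d)
  have hsupply := fun l => aestronglyMeasurable_supply env hr hreg hρ hη hd l
  have hpay : ∀ x : Ω → Decision N, (∀ l, AEStronglyMeasurable (fun ω => (x ω).price l) P) →
      (∀ l, AEStronglyMeasurable (fun ω => (x ω).supply l) P) →
      AEStronglyMeasurable (fun ω => M.payoff θ (x ω) (ε d ω)) P := by
    intro x hx hx'
    refine (Finset.aestronglyMeasurable_fun_sum _ fun l _ => ?_).sub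
      (Finset.aestronglyMeasurable_fun_sum _ fun l _ => ((hx' l).const_mul _).mul_const _)
    refine (AEStronglyMeasurable.const_mul ?_ _).mul (hx l)
    exact ((aestronglyMeasurable_const.sub ((hx l).const_mul _)).add (hε l)).inf (hx' l)
  have hS := M.one_le_size
  refine Integrable.of_bound ((hpay _ (fun l => aestronglyMeasurable_const)
    (fun l => aestronglyMeasurable_const)).sub (hpay _ hprice hsupply))
    (M.gapConst ρ * (4 * M.size * Fintype.card (Link N) + 1)) ?_
  filter_upwards [hreg] with ω hω
  rw [Real.norm_eq_abs]
  refine (hω.abs_gap_le hr hρ hη hd).trans ?_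
  refine mul_le_mul_of_nonneg_left (add_le_add ?_ (rpow_neg_le_one (by omega) hη))
    (M.gapConst_nonneg hρ)
  exact (inBox_est hr.params_mem hω.guess_mem _).paramDist_le hr.params_mem

lemma integral_gap_le (hη2 : η < 1 / 2) (hD : 1 ≤ Real.log D) {d : ℕ} (hd : d < D) :
    ∫ ω, (M.payoff θ (M.optimal F θ) (ε d ω)
      - M.payoff θ (M.policy F ρ η (θ₀ ω) d
          (history θ (M.policy F ρ η (θ₀ ω)) (fun d => ε d ω) d)) (ε d ω)) ∂P ≤
      M.gapConst ρ * ((if d < 2 then 4 * M.size * Fintype.card (Link N) else 0)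
        + 3 * M.errorConst ρ * Fintype.card (Link N) * √(M.normConst ρ η * Real.log D)
          * ((d + 1 : ℕ) : ℝ) ^ (-(1 / 2 - η)) + ((d + 1 : ℕ) : ℝ) ^ (-η)) := by
  obtain ⟨R, hR, hle, hRint⟩ := exists_error_bound env hr hreg hρ hη hη2 hD hd
  have hG := M.gapConst_nonneg hρ
  calc _ ≤ ∫ ω, M.gapConst ρ * (R ω + ((d + 1 : ℕ) : ℝ) ^ (-η)) ∂P := by
        refine integral_mono_ae (integrable_gap env hr hreg hρ hη hd)
          ((hR.add (integrable_const _)).const_mul _) ?_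
        filter_upwards [hreg, hle] with ω hω h
        refine (le_abs_self _).trans ((hω.abs_gap_le hr hρ hη hd).trans ?_)
        exact mul_le_mul_of_nonneg_left (add_le_add_left h _) hG
    _ = M.gapConst ρ * (∫ ω, R ω ∂P + ((d + 1 : ℕ) : ℝ) ^ (-η)) := by
        rw [integral_const_mul, integral_add hR (integrable_const _)]
        simp
    _ ≤ _ := by
        rw [neg_sub]
        exact mul_le_mul_of_nonneg_left (add_le_add_left hRint _) hG

/-- The regret bound, with explicit constants. -/
lemma regret_le (hη0 : 0 < η) (hη2 : η < 1 / 2) (hD : 1 ≤ Real.log D) (hD2 : 2 ≤ D) :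
    Integrable (fun ω => M.averageGap F θ (M.policy F ρ η (θ₀ ω)) (fun d => ε d ω) D) P ∧
    M.regret P F θ (fun ω => M.policy F ρ η (θ₀ ω)) ε D ≤
      M.gapConst ρ * (8 * M.size * Fintype.card (Link N)) * (D : ℝ)⁻¹
      + M.gapConst ρ * (6 * M.errorConst ρ * Fintype.card (Link N) * √(M.normConst ρ η))
        * Real.log D ^ (1 / 2 : ℝ) * (D : ℝ) ^ (η - 1 / 2)
      + 2 * M.gapConst ρ * (D : ℝ) ^ (-η) := by
  have hgap := fun d (hd : d ∈ Finset.range D) =>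
    integrable_gap env hr hreg hρ hη (Finset.mem_range.1 hd)
  refine ⟨(integrable_finsetSum _ hgap).const_mul _, ?_⟩
  have hD0 : (0 : ℝ) < D := by exact_mod_cast (by omega : 0 < D)
  have hG := M.gapConst_nonneg hρ
  have hK := M.errorConst_pos hρ
  have hA := M.normConst_pos ρ η
  have hS := M.one_le_size
  unfold regret averageGap
  rw [integral_const_mul, integral_finsetSum _ hgap]
  set T := 4 * M.size * Fintype.card (Link N) with hT
  set V := 3 * M.errorConst ρ * Fintype.card (Link N) * √(M.normConst ρ η * Real.log D) with hV
  have hV0 : 0 ≤ V := by positivity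
  have h1 : ∑ d ∈ Finset.range D, (if d < 2 then T else 0) = 2 * T := by
    rw [← Finset.sum_filter, show (Finset.range D).filter (· < 2) = Finset.range 2 by
      ext d; simp; omega]
    simp
  have h2 := sum_rpow_neg_le (a := 1 / 2 - η) (by linarith) (by linarith) D
  have h3 := sum_rpow_neg_le hη0 (by linarith) D
  -- Both exponents `a` are below `1 / 2`, hence `1 / (1 - a) ≤ 2`; the factor `D` cancels against
  -- the average.
  have h2' : (D : ℝ) ^ (1 - (1 / 2 - η)) / (1 - (1 / 2 - η)) ≤ 2 * (D * (D : ℝ) ^ (η - 1 / 2)) := by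
    rw [show 1 - (1 / 2 - η) = 1 + (η - 1 / 2) by ring, Real.rpow_add hD0, Real.rpow_one,
      div_le_iff₀ (by linarith)]
    have : 0 ≤ D * (D : ℝ) ^ (η - 1 / 2) := by positivity
    nlinarith
  have h3' : (D : ℝ) ^ (1 - η) / (1 - η) ≤ 2 * (D * (D : ℝ) ^ (-η)) := by
    rw [sub_eq_add_neg, Real.rpow_add hD0, Real.rpow_one, div_le_iff₀ (by linarith)]
    have : 0 ≤ D * (D : ℝ) ^ (-η) := by positivity
    nlinarith
  have hsum : ∑ d ∈ Finset.range D, ∫ ω, (M.payoff θ (M.optimal F θ) (ε d ω)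
      - M.payoff θ (M.policy F ρ η (θ₀ ω) d
          (history θ (M.policy F ρ η (θ₀ ω)) (fun d => ε d ω) d)) (ε d ω)) ∂P ≤
      M.gapConst ρ * (2 * T + V * (2 * (D * (D : ℝ) ^ (η - 1 / 2)))
        + 2 * (D * (D : ℝ) ^ (-η))) := by
    refine (Finset.sum_le_sum fun d hd => integral_gap_le env hr hreg hρ hη hη2 hD
      (Finset.mem_range.1 hd)).trans ?_
    rw [← Finset.mul_sum, Finset.sum_add_distrib, Finset.sum_add_distrib, h1, ← Finset.mul_sum]
    refine mul_le_mul_of_nonneg_left (add_le_add (add_le_add le_rfl ?_) (h3.trans h3')) hG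
    exact mul_le_mul_of_nonneg_left (h2.trans h2') hV0
  refine (mul_le_mul_of_nonneg_left hsum (by positivity : 0 ≤ 1 / (D : ℝ))).trans (le_of_eq ?_)
  rw [hV, hT, Real.sqrt_mul hA.le, Real.sqrt_eq_rpow (Real.log D)]
  field_simp
  ring

end Regret

end Market

end NRPS

end

/-! ### The theorem. -/

theorem theorem2 (N : ℕ) (M : NRPS.Market N) :
    ∃ (Φ₂ Φ₃ Φ₄ : ℝ → ℝ → ℝ) (K : ℝ → ℝ),
      (∀ ρ η : ℝ, 0 < ρ → 0 < η → η < 1 / 2 → 0 < Φ₂ ρ η ∧ 0 < Φ₃ ρ η ∧ 0 < Φ₄ ρ η) ∧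
      ∀ (Ω : Type*) [MeasurableSpace Ω] (P : Measure Ω) [IsProbabilityMeasure P]
        (θ : NRPS.Params N) (F : NRPS.Link N → Measure ℝ) (ε : ℕ → Ω → NRPS.Link N → ℝ)
        (θ₀ : Ω → NRPS.Params N),
        M.IsEnvironment P θ F ε θ₀ →
        ∀ ρ η : ℝ, 0 < ρ → 0 < η → η < 1 / 2 →
        ∀ D : ℕ, 4 + Real.exp (1 / (1 - 2 * η)) < (D : ℝ) →
        -- no price cap binds in the clairvoyant problem
        M.CapsInactive F θ →
        -- no price cap binds in the problems that the policy solves on the odd days up to day D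
        (∀ᵐ ω ∂P, ∀ n : ℕ, Even n → n < D →
          M.CapsInactive F (M.estimate (θ₀ ω)
            (NRPS.history θ (M.policy F ρ η (θ₀ ω)) (fun d => ε d ω) n))) →
        Integrable (fun ω =>
          M.averageGap F θ (M.policy F ρ η (θ₀ ω)) (fun d => ε d ω) D) P ∧
        M.regret P F θ (fun ω => M.policy F ρ η (θ₀ ω)) ε D <
          Φ₂ ρ η * (D : ℝ)⁻¹
            + Φ₃ ρ η * Real.log D ^ (1 / 2 : ℝ) * (D : ℝ) ^ (η - 1 / 2)
            + Φ₄ ρ η * (D : ℝ) ^ (-η) ∧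
        (η = 1 / 4 →
          M.regret P F θ (fun ω => M.policy F ρ η (θ₀ ω)) ε D ≤
            K ρ * (Real.log D ^ (1 / 2 : ℝ) * (D : ℝ) ^ (-(1 / 4) : ℝ))) := by
  have hG : ∀ ρ : ℝ, 0 < ρ → 0 ≤ M.gapConst ρ := fun ρ hρ => M.gapConst_nonneg hρ
  have hS := M.one_le_size
  -- The summands `+ 1` make the three functions positive and the final inequality strict.
  set Φ₂ : ℝ → ℝ → ℝ := fun ρ _ =>
    M.gapConst ρ * (8 * M.size * Fintype.card (NRPS.Link N)) + 1 with hΦ₂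
  set Φ₃ : ℝ → ℝ → ℝ := fun ρ η =>
    M.gapConst ρ * (6 * M.errorConst ρ * Fintype.card (NRPS.Link N) * √(M.normConst ρ η)) + 1
    with hΦ₃
  set Φ₄ : ℝ → ℝ → ℝ := fun ρ _ => 2 * M.gapConst ρ + 1 with hΦ₄
  have hpos : ∀ ρ η : ℝ, 0 < ρ → 0 < Φ₂ ρ η ∧ 0 < Φ₃ ρ η ∧ 0 < Φ₄ ρ η := by
    intro ρ η hρ
    have h1 := hG ρ hρ
    have h2 := M.errorConst_pos hρ
    refine ⟨?_, ?_, ?_⟩ <;> positivity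
  refine ⟨Φ₂, Φ₃, Φ₄, fun ρ => Φ₂ ρ (1 / 4) + Φ₃ ρ (1 / 4) + Φ₄ ρ (1 / 4),
    fun ρ η hρ _ _ => hpos ρ η hρ, ?_⟩
  intro Ω _ P _ θ F ε θ₀ env ρ η hρ hη hη2 D hD hcaps hpath
  have hr := env.isRegular hcaps
  have hreg : ∀ᵐ ω ∂P, M.IsRegularPath F θ ρ η (θ₀ ω) (fun d => ε d ω) D := by
    filter_upwards [env.guess_mem, env.ae_shock_le, hpath] with ω h1 h2 h3
    exact ⟨h1, h2, h3⟩
  -- Since `1 / (1 - 2 η) ≥ 1`, the lower bound on `D` exceeds `e`, which gives `1 ≤ log D`.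
  have hexp : Real.exp 1 ≤ Real.exp (1 / (1 - 2 * η)) := by
    refine Real.exp_le_exp.2 ?_
    rw [le_div_iff₀ (by linarith)]
    linarith
  have hD4 : (4 : ℝ) < D := by linarith [Real.exp_pos (1 / (1 - 2 * η))]
  have hD2 : 2 ≤ D := by
    have : 4 < D := by exact_mod_cast hD4
    omega
  have hD0 : (0 : ℝ) < D := by linarith
  have hlog : 1 ≤ Real.log D := by
    rw [Real.le_log_iff_exp_le hD0]
    linarith
  obtain ⟨hint, hle⟩ := NRPS.Market.regret_le env hr hreg hρ hη.le hη hη2 hlog hD2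
  have hlog2 : 1 ≤ Real.log D ^ (1 / 2 : ℝ) := Real.one_le_rpow hlog (by norm_num)
  have hlt : M.regret P F θ (fun ω => M.policy F ρ η (θ₀ ω)) ε D <
      Φ₂ ρ η * (D : ℝ)⁻¹ + Φ₃ ρ η * Real.log D ^ (1 / 2 : ℝ) * (D : ℝ) ^ (η - 1 / 2)
        + Φ₄ ρ η * (D : ℝ) ^ (-η) := by
    refine hle.trans_lt ?_
    have h1 : 0 < (D : ℝ)⁻¹ := by positivity
    have h2 : 0 < Real.log D ^ (1 / 2 : ℝ) * (D : ℝ) ^ (η - 1 / 2) := by positivity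
    have h3 : 0 < (D : ℝ) ^ (-η) := by positivity
    simp only [hΦ₂, hΦ₃, hΦ₄]
    linarith
  refine ⟨hint, hlt, ?_⟩
  rintro rfl
  refine hlt.le.trans ?_
  obtain ⟨p2, p3, p4⟩ := hpos ρ (1 / 4) hρ
  -- At `η = 1 / 4` the other two rates are dominated by the one with the logarithm.
  have h1 : (D : ℝ)⁻¹ ≤ Real.log D ^ (1 / 2 : ℝ) * (D : ℝ) ^ (-(1 / 4) : ℝ) := by
    rw [← Real.rpow_neg_one]
    have : (D : ℝ) ^ (-1 : ℝ) ≤ (D : ℝ) ^ (-(1 / 4) : ℝ) :=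
      Real.rpow_le_rpow_of_exponent_le (by linarith) (by norm_num)
    exact this.trans (le_mul_of_one_le_left (by positivity) hlog2)
  have h2 : (D : ℝ) ^ (-(1 / 4) : ℝ) ≤ Real.log D ^ (1 / 2 : ℝ) * (D : ℝ) ^ (-(1 / 4) : ℝ) :=
    le_mul_of_one_le_left (by positivity) hlog2
  have h3 := mul_le_mul_of_nonneg_left h1 p2.le
  have h4 := mul_le_mul_of_nonneg_left h2 p4.le
  rw [show (1 / 4 - 1 / 2 : ℝ) = -(1 / 4) by norm_num, mul_assoc (Φ₃ _ _)]
  simp only [add_mul (_ + _) (Φ₄ _ _), add_mul (Φ₂ _ _) (Φ₃ _ _)]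
  exact add_le_add_three h3 le_rfl h4
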